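/- **Proposition.** Let $K$ be a set of $k\ge 1$ points of the $n\times n$ grid $\{0,\dots,n-1\}^2$, where $n>k$, and let $v_{low}=(x_{low},y_{low})$ be a point of $K$ with smallest $y$-coordinate (ties broken arbitrarily). A *rectilinear Steiner tree* (RST) for $K$ is a tree whose vertices are finitely many points of the plane, including all points of $K$, and whose edges are horizontal or vertical line segments meeting only in common endpoints. A *matching* of a graph is a set of pairwise disjoint edges; it is *odd* if exactly one vertex, the *isolated* vertex, is not covered. A *flip* removes one edge of an odd matching and inserts an edge of the graph incident to the isolated vertex so that the result is again an odd matching; the length of a flip sequence is its number of flips. *Construction.* Put $N=8n(n+4n^2)$ and $K'=\{(8nx+1,\,8n(y-y_{low})+1) : (x,y)\in K\}\subseteq\{1,\dots,N\}^2$. Let $G$ be the $(4N+1)\times(2N+1)$ square grid graph with columns $0,\dots,4N$ and rows $0,\dots,2N$ (numbered from the bottom). For $(a,b)\in\{1,\dots,N\}^2$, the block $B_{a,b}$ consists of the eight vertices in columns $4(a-1),\dots,4(a-1)+3$ and rows $2b-1,2b$. The odd matchings $M_{in}$ and $M_{tar}$ of $G$ are as follows. - If $(a,b)\notin K'$, both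 contain the four horizontal edges of $B_{a,b}$ that join its first to its second and its third to its fourth column. - If $(a,b)\in K'$, $M_{in}$ contains those four edges of $B_{a,b}$, while $M_{tar}$ contains the other four edges of the $8$-cycle around $B_{a,b}$: the vertical edges in its first and fourth columns and the two horizontal edges between its second and third columns. - In both, the isolated vertex is the vertex of row $0$ in column $c=32n\,x_{low}+2$ (below the third column of the block of $v_{low}$); the remaining vertices of row $0$ are matched by horizontal edges, from left to right in consecutive pairs on each side of column $c$; and the vertices of column $4N$ in rows $1,\dots,2N$ are matched by the vertical edges joining rows $2j-1$ and $2j$, $1\le j\le N$. *Claim.* $M_{in}$ and $M_{tar}$ are odd matchings of $G$, and for every integer $\ell\ge 0$, there is an RST for $K$ of total edge length at most $\ell$ if and only if there is a flip sequence in $G$ transforming $M_{in}$ into $M_{tar}$ of length at most $4\cdot 8n\cdot\ell+8k$. -/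

import Mathlib

open scoped SimpleGraph

/-! ### Rectilinear Steiner trees in the plane -/

/-- A rectilinear Steiner tree for a set `K` of points of the plane: a tree on finitely many points
of the plane, containing `K` among its vertices, whose edges are horizontal or vertical line
segments that meet only in common endpoints. -/
structure RectilinearSteinerTree (K : Set (ℝ × ℝ)) where
  verts : Finset (ℝ × ℝ)
  graph : SimpleGraph verts
  isTree : graph.IsTree
  terminals_subset : K ⊆ (verts : Set (ℝ × ℝ))
  rectilinear : ∀ u v, graph.Adj u v → u.1.1 = v.1.1 ∨ u.1.2 = v.1.2
  plane : ∀ a b c d, graph.Adj a b → graph.Adj c d → s(a, b) ≠ s(c, d) →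
    segment ℝ a.1 b.1 ∩ segment ℝ c.1 d.1 ⊆ ({a.1, b.1} ∩ {c.1, d.1} : Set (ℝ × ℝ))

/-- The length of a horizontal or vertical line segment with the given endpoints. -/
def segmentLength : Sym2 (ℝ × ℝ) → ℝ :=
  Sym2.lift ⟨fun p q => |p.1 - q.1| + |p.2 - q.2|, fun p q => by
    simp only [abs_sub_comm]⟩

open Classical in
/-- The total edge length of a rectilinear Steiner tree. -/
noncomputable def RectilinearSteinerTree.length {K : Set (ℝ × ℝ)}
    (T : RectilinearSteinerTree K) : ℝ :=
  ∑ e ∈ T.graph.edgeFinset, segmentLength (e.map Subtype.val)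

/-- The points of the `n × n` grid (coordinates `0, …, n - 1`) as points of the plane. -/
def planePoints {n : ℕ} (K : Finset (Fin n × Fin n)) : Set (ℝ × ℝ) :=
  {p | ∃ v ∈ K, p = (((v.1 : ℕ) : ℝ), ((v.2 : ℕ) : ℝ))}

/-! ### Odd matchings and flips -/

/-- `M` is an odd matching of `G`: a set of pairwise disjoint edges that leaves exactly one vertex
uncovered. -/
structure IsOddMatching {V : Type*} (G : SimpleGraph V) (M : Set (Sym2 V)) : Prop where
  subset_edgeSet : M ⊆ G.edgeSet
  disjoint : ∀ e ∈ M, ∀ f ∈ M, ∀ v, v ∈ e → v ∈ f → e = f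
  odd : ∃! v, ∀ e ∈ M, v ∉ e

/-- A flip removes an edge of an odd matching and replaces it with an edge of `G` incident to the
isolated vertex, so that the result is again an odd matching. -/
def IsFlip {V : Type*} (G : SimpleGraph V) (M M' : Set (Sym2 V)) : Prop :=
  IsOddMatching G M ∧ IsOddMatching G M' ∧
    ∃ e ∈ M, ∃ f ∈ G.edgeSet, (∃ v ∈ f, ∀ g ∈ M, v ∉ g) ∧ M' = insert f (M \ {e})

/-- There is a sequence of exactly `m` flips transforming `M` into `M'`. -/
def HasFlipSequence {V : Type*} (G : SimpleGraph V) (M M' : Set (Sym2 V)) (m : ℕ) : Prop :=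
  ∃ s : ℕ → Set (Sym2 V), s 0 = M ∧ s m = M' ∧ ∀ i < m, IsFlip G (s i) (s (i + 1))

/-! ### The construction -/

/-- The `w × h` square grid graph; a vertex is given by its column and its row, the rows being
numbered from bottom to top. -/
abbrev gridGraph (w h : ℕ) : SimpleGraph (Fin w × Fin h) :=
  SimpleGraph.pathGraph w □ SimpleGraph.pathGraph h

/-- The side length of the refined grid `{1, …, N} × {1, …, N}`. -/
def refinedSide (n : ℕ) : ℕ := 8 * n * (n + 4 * n ^ 2)

/-- The vertices of the refined grid. -/
def refinedGrid (n : ℕ) : Set (ℕ × ℕ) :=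
  {v | v.1 ∈ Set.Icc 1 (refinedSide n) ∧ v.2 ∈ Set.Icc 1 (refinedSide n)}

/-- The position in the refined grid of a point `v`, after a vertical translation that gives the
lowest terminal `low` the height `0`. -/
def refinePoint {n : ℕ} (low v : Fin n × Fin n) : ℕ × ℕ :=
  (8 * n * (v.1 : ℕ) + 1, 8 * n * ((v.2 : ℕ) - (low.2 : ℕ)) + 1)

/-- The refined set of terminals. -/
def refinedTerminals {n : ℕ} (K : Finset (Fin n × Fin n)) (low : Fin n × Fin n) : Set (ℕ × ℕ) :=
  {p | ∃ v ∈ K, p = refinePoint low v}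

/-- Every vertex of the refined grid is replaced by a block of `4 × 2` vertices (four columns, two
rows); this is the bottom left vertex of the block. Row `0` is left free for the additional row. -/
def blockCorner (v : ℕ × ℕ) : ℕ × ℕ := (4 * (v.1 - 1), 2 * (v.2 - 1) + 1)

/-- The perfect matching of a block by four horizontal edges. -/
def horizontalEdges (v : ℕ × ℕ) : Set (Sym2 (ℕ × ℕ)) :=
  let x := (blockCorner v).1
  let y := (blockCorner v).2
  {s((x, y), (x + 1, y)), s((x + 2, y), (x + 3, y)),
    s((x, y + 1), (x + 1, y + 1)), s((x + 2, y + 1), (x + 3, y + 1))}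

/-- The other four edges of the cycle of length eight around a block. -/
def switchedEdges (v : ℕ × ℕ) : Set (Sym2 (ℕ × ℕ)) :=
  let x := (blockCorner v).1
  let y := (blockCorner v).2
  {s((x, y), (x, y + 1)), s((x + 1, y), (x + 2, y)),
    s((x + 1, y + 1), (x + 2, y + 1)), s((x + 3, y), (x + 3, y + 1))}

/-- The column of the isolated vertex: the third column of the block of the lowest terminal. -/
def holeColumn {n : ℕ} (low : Fin n × Fin n) : ℕ := (blockCorner (refinePoint low low)).1 + 2

/-- The matching edges in the additional bottom row (row `0`), left and right of the isolated
vertex, and in the additional right column (column `4 N`). -/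
def borderEdges {n : ℕ} (low : Fin n × Fin n) : Set (Sym2 (ℕ × ℕ)) :=
  {e | ∃ i, 2 * i + 1 < holeColumn low ∧ e = s((2 * i, 0), (2 * i + 1, 0))} ∪
  {e | ∃ i, holeColumn low + 2 * i + 2 ≤ 4 * refinedSide n ∧
    e = s((holeColumn low + 2 * i + 1, 0), (holeColumn low + 2 * i + 2, 0))} ∪
  {e | ∃ j < refinedSide n,
    e = s((4 * refinedSide n, 2 * j + 1), (4 * refinedSide n, 2 * j + 2))}

/-- The matching that uses `g v` in the block of every terminal `v` and horizontal edges in all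
other blocks. -/
def blockMatching {n : ℕ} (K : Finset (Fin n × Fin n)) (low : Fin n × Fin n)
    (g : ℕ × ℕ → Set (Sym2 (ℕ × ℕ))) : Set (Sym2 (ℕ × ℕ)) :=
  borderEdges low ∪ (⋃ v ∈ refinedGrid n \ refinedTerminals K low, horizontalEdges v) ∪
    ⋃ v ∈ refinedTerminals K low, g v

/-- The grid graph in which the matchings live. -/
abbrev reductionGraph (n : ℕ) :
    SimpleGraph (Fin (4 * refinedSide n + 1) × Fin (2 * refinedSide n + 1)) :=
  gridGraph (4 * refinedSide n + 1) (2 * refinedSide n + 1)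

/-- A set of pairs of points with natural coordinates, as a set of pairs of vertices of a grid. -/
def inGrid (w h : ℕ) (S : Set (Sym2 (ℕ × ℕ))) : Set (Sym2 (Fin w × Fin h)) :=
  {e | e.map (fun p => ((p.1 : ℕ), (p.2 : ℕ))) ∈ S}

/-- The initial odd matching. -/
def initialMatching {n : ℕ} (K : Finset (Fin n × Fin n)) (low : Fin n × Fin n) :
    Set (Sym2 (Fin (4 * refinedSide n + 1) × Fin (2 * refinedSide n + 1))) :=
  inGrid _ _ (blockMatching K low horizontalEdges)

/-- The target odd matching. -/
def targetMatching {n : ℕ} (K : Finset (Fin n × Fin n)) (low : Fin n × Fin n) :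
    Set (Sym2 (Fin (4 * refinedSide n + 1) × Fin (2 * refinedSide n + 1))) :=
  inGrid _ _ (blockMatching K low switchedEdges)

/-! A flip slides the isolated vertex (the hole) from `v` across a neighbour `w` to the partner `u`
of `w`. Above row 0 and left of the last column, the initial matching consists of horizontal dimers.
Through untouched dimers the hole moves right in odd rows, left in even rows, and up or down
anywhere. A block is two dimers wide and two high, so one unit of the original grid is `16 * n`
dimers in either direction. Flip sequences thus explore scaled copies of rectilinear trees, and
rounding absorbs the lower-order terms. Trees on both sides are stored as `Grown`: points joined one
at a time, with total cost.

From a tree to flips: the tree is brought to a binary form whose leaves are the terminals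
(`Grown.exists_normalTree`), so that it has at most `2k - 2` edges however many Steiner points it
had. The hole follows each edge horizontally, then vertically; one additional dimer per edge
suffices to change to a row of the right direction, and three more complete the block at each leaf.
With the arm from the start to the root this gives a set `D` of at most `16nL + 5k` dimers for a
tree of length `L`. Every dimer is visited by an excursion of two flips, out and back, except that a
terminal block is switched by going round its 8-cycle in five flips instead of eight
(`hasFlipSequence_of_spread`). The number of flips is `2 * |D| - 3k ≤ 32nL + 7k`.

From flips to a tree: whenever the hole enters untouched territory, one initial edge is removed for
the first time and one edge outside the initial matching is inserted there, and the explored region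
grows by at most one dimer step. Every flip removes one edge, and at most `4k` new edges remain at
the end, so the region has a tree of cost `l` with `2l ≤ m + 4k` (`exists_grown_of_flips`). It meets
all terminal blocks. Since `k < n`, dividing by `16n` gives length less than `ℓ + 1`. The term `4n²`
in `N` keeps the hole away from the last column, except when `ℓ ≥ n² - 1`; then a spanning tree of
the whole grid is short enough.

Rounding (`Grown.round`): shift both coordinates randomly and round down. Expected distances are
preserved and grid points stay fixed, so some shift yields an integral tree that is no longer;
length less than `ℓ + 1` then means at most `ℓ`. -/

/-! ### Odd matchings and flips -/

section Flips

variable {V : Type*} {G : SimpleGraph V} {M M' M'' C C' H S : Set (Sym2 V)} {u v w : V}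

/-- The vertex `v` is not covered by `M`. -/
def Isolated (M : Set (Sym2 V)) (v : V) : Prop := ∀ e ∈ M, v ∉ e

theorem IsOddMatching.isolated_unique (hM : IsOddMatching G M) (hu : Isolated M u)
    (hv : Isolated M v) : u = v :=
  hM.odd.unique hu hv

theorem IsOddMatching.exists_isolated (hM : IsOddMatching G M) : ∃ v, Isolated M v :=
  hM.odd.exists

theorem IsOddMatching.exists_mate (hM : IsOddMatching G M) (hv : Isolated M v) (hwv : w ≠ v) :
    ∃ u, s(w, u) ∈ M := by
  have : ¬ Isolated M w := fun h => hwv (hM.isolated_unique h hv)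
  simp only [Isolated, not_forall, not_not] at this
  obtain ⟨e, he, hw⟩ := this
  obtain ⟨u, rfl⟩ := hw
  exact ⟨u, he⟩

theorem IsOddMatching.mate_unique (hM : IsOddMatching G M) {a : V} (h₁ : s(w, u) ∈ M)
    (h₂ : s(w, a) ∈ M) : u = a := by
  exact Sym2.congr_right.1 (hM.disjoint _ h₁ _ h₂ w (by simp) (by simp))

/-- Sliding the isolated vertex `v` along a neighbour `w` to the mate `u` of `w`. -/
theorem IsOddMatching.slide (hM : IsOddMatching G M) (hv : Isolated M v) (hvw : G.Adj v w)
    (hwu : s(w, u) ∈ M) :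
    IsOddMatching G (insert s(v, w) (M \ {s(w, u)})) ∧
      Isolated (insert s(v, w) (M \ {s(w, u)})) u := by
  have huv : u ≠ v := by
    rintro rfl
    exact hv _ hwu (by simp)
  have huw : u ≠ w := by
    rintro rfl
    exact G.loopless.irrefl _ (hM.subset_edgeSet hwu)
  have hiso : Isolated (insert s(v, w) (M \ {s(w, u)})) u := by
    rintro e (rfl | ⟨he, hne⟩) hu
    · simp [huv, huw] at hu
    · exact hne (hM.disjoint _ he _ hwu u hu (by simp))
  have key : ∀ e ∈ M \ {s(w, u)}, ∀ x, x ∈ e → x ∉ s(v, w) := by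
    rintro e ⟨he, hne⟩ x hx hx'
    rcases Sym2.mem_iff.1 hx' with rfl | rfl
    · exact hv _ he hx
    · exact hne (hM.disjoint _ he _ hwu x hx (by simp))
  refine ⟨⟨?_, ?_, u, hiso, ?_⟩, hiso⟩
  · rintro e (rfl | he)
    · exact hvw
    · exact hM.subset_edgeSet he.1
  · rintro e (rfl | he) f (rfl | hf) x hx hx'
    · rfl
    · exact absurd hx (key _ hf x hx')
    · exact absurd hx' (key _ he x hx)
    · exact hM.disjoint e he.1 f hf.1 x hx hx'
  · intro x hx
    by_contra hxu
    have hxv : x ≠ v := by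
      rintro rfl
      exact hx _ (Or.inl rfl) (by simp)
    have hxw : x ≠ w := by
      rintro rfl
      exact hx _ (Or.inl rfl) (by simp)
    obtain ⟨y, hy⟩ := hM.exists_mate hv hxv
    refine hx _ (Or.inr ⟨hy, ?_⟩) (Sym2.mem_mk_left x y)
    intro h
    have : x ∈ s(w, u) := by
      rw [← Set.mem_singleton_iff.1 h]; simp
    simp [hxw, hxu] at this

theorem IsOddMatching.isFlip_slide (hM : IsOddMatching G M) (hv : Isolated M v)
    (hvw : G.Adj v w) (hwu : s(w, u) ∈ M) :
    IsFlip G M (insert s(v, w) (M \ {s(w, u)})) :=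
  ⟨hM, (hM.slide hv hvw hwu).1, _, hwu, _, hvw, ⟨v, by simp, hv⟩, rfl⟩

/-- Every flip slides the isolated vertex. -/
theorem IsFlip.exists_slide (h : IsFlip G M M') :
    ∃ v w u, Isolated M v ∧ G.Adj v w ∧ s(w, u) ∈ M ∧ Isolated M' u ∧
      M' = insert s(v, w) (M \ {s(w, u)}) := by
  obtain ⟨hM, hM', e, he, f, hf, ⟨v, hvf, hv⟩, rfl⟩ := h
  obtain ⟨w, rfl⟩ := hvf
  have hvw : G.Adj v w := hf
  obtain ⟨u, hu⟩ := hM.exists_mate hv hvw.ne'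
  -- The new edge and the old edge at `w` cannot coexist, so the removed edge must be the old one.
  have heq : e = s(w, u) := by
    by_contra hne
    have := hM'.disjoint s(v, w) (Or.inl rfl) s(w, u) (Or.inr ⟨hu, fun h => hne h.symm⟩) w
      (by simp) (by simp)
    exact hv _ hu (this ▸ Sym2.mem_mk_left v w)
  subst heq
  exact ⟨v, w, u, hv, hvw, hu, (hM.slide hv hvw hu).2, rfl⟩

/-- `S` is a matching covering the same vertices as `H`. -/
structure IsSwitch (G : SimpleGraph V) (H S : Set (Sym2 V)) : Prop where
  subset_edgeSet : S ⊆ G.edgeSet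
  disjoint : ∀ e ∈ S, ∀ f ∈ S, ∀ v, v ∈ e → v ∈ f → e = f
  cover : ∀ v, (∃ e ∈ H, v ∈ e) ↔ ∃ e ∈ S, v ∈ e

theorem IsSwitch.isolated_iff (hS : IsSwitch G H S) (hH : H ⊆ M) :
    Isolated (M \ H ∪ S) v ↔ Isolated M v := by
  constructor
  · intro h e he hve
    by_cases heH : e ∈ H
    · obtain ⟨f, hf, hvf⟩ := (hS.cover v).1 ⟨e, heH, hve⟩
      exact h f (Or.inr hf) hvf
    · exact h e (Or.inl ⟨he, heH⟩) hve
  · rintro h e (he | he) hve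
    · exact h e he.1 hve
    · obtain ⟨f, hf, hvf⟩ := (hS.cover v).2 ⟨e, he, hve⟩
      exact h f (hH hf) hvf

theorem IsSwitch.isOddMatching (hS : IsSwitch G H S) (hM : IsOddMatching G M) (hH : H ⊆ M) :
    IsOddMatching G (M \ H ∪ S) := by
  have key : ∀ e ∈ M \ H, ∀ f ∈ S, ∀ v, v ∈ e → v ∉ f := by
    intro e he f hf v hve hvf
    obtain ⟨g, hg, hvg⟩ := (hS.cover v).2 ⟨f, hf, hvf⟩
    exact he.2 (hM.disjoint e he.1 g (hH hg) v hve hvg ▸ hg)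
  refine ⟨?_, ?_, ?_⟩
  · rintro e (he | he)
    · exact hM.subset_edgeSet he.1
    · exact hS.subset_edgeSet he
  · rintro e (he | he) f (hf | hf) v hve hvf
    · exact hM.disjoint e he.1 f hf.1 v hve hvf
    · exact absurd hvf (key e he f hf v hve)
    · exact absurd hve (key f hf e he v hvf)
    · exact hS.disjoint e he f hf v hve hvf
  · obtain ⟨v, hv⟩ := hM.exists_isolated
    refine ⟨v, (hS.isolated_iff hH).2 hv, fun u hu => ?_⟩
    exact hM.isolated_unique ((hS.isolated_iff hH).1 hu) hv

/-- A flip that leaves `H` in place only sees which vertices `H` covers, and `S` covers the same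
ones; hence it can equally be performed with `S` in place of `H`. -/
theorem IsSwitch.isFlip (hS : IsSwitch G H S) (h : IsFlip G M M') (hH : H ⊆ M) (hH' : H ⊆ M') :
    IsFlip G (M \ H ∪ S) (M' \ H ∪ S) := by
  obtain ⟨v, w, u, hv, hvw, hwu, hu, hM'⟩ := h.exists_slide
  have hwuH : s(w, u) ∉ H := fun hmem => hu _ (hH' hmem) (by simp)
  have hvwH : s(v, w) ∉ H := fun hmem => hv _ (hH hmem) (by simp)
  have hwuS : s(w, u) ∉ S := by
    intro hmem
    obtain ⟨e, he, hue⟩ := (hS.cover u).2 ⟨_, hmem, by simp⟩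
    exact hu _ (hH' he) hue
  have heq : M' \ H ∪ S = insert s(v, w) ((M \ H ∪ S) \ {s(w, u)}) := by
    subst hM'
    ext e
    simp only [Set.mem_union, Set.mem_sdiff, Set.mem_insert_iff, Set.mem_singleton_iff]
    constructor
    · rintro (⟨h | h, h'⟩ | h)
      · exact Or.inl h
      · exact Or.inr ⟨Or.inl ⟨h.1, h'⟩, h.2⟩
      · refine Or.inr ⟨Or.inr h, ?_⟩
        rintro rfl
        exact hwuS h
    · rintro (rfl | ⟨h | h, h'⟩)
      · exact Or.inl ⟨Or.inl rfl, hvwH⟩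
      · exact Or.inl ⟨Or.inr ⟨h.1, h'⟩, h.2⟩
      · exact Or.inr h
  rw [heq]
  exact (hS.isOddMatching h.1 hH).isFlip_slide ((hS.isolated_iff hH).2 hv) hvw
    (Or.inl ⟨hwu, hwuH⟩)

/-- `FlipTour G C M M' m P`: there is a sequence of `m` flips from `M` to `M'` along which the edges
of `C` are never touched, and `P` is the set of vertices that are isolated at some time. -/
inductive FlipTour (G : SimpleGraph V) (C : Set (Sym2 V)) :
    Set (Sym2 V) → Set (Sym2 V) → ℕ → Set V → Prop
  | nil {M : Set (Sym2 V)} {v : V} : IsOddMatching G M → Isolated M v → C ⊆ M → FlipTour G C M M 0 {v}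
  | cons {M M' M'' : Set (Sym2 V)} {v : V} {m : ℕ} {P : Set V} :
      Isolated M v → C ⊆ M → IsFlip G M M' → FlipTour G C M' M'' m P →
      FlipTour G C M M'' (m + 1) (insert v P)

/-! ### Composing tours and inserting excursions. -/

namespace FlipTour

variable {m m' : ℕ} {P P' : Set V}

theorem subset_left (h : FlipTour G C M M' m P) : C ⊆ M := by
  cases h <;> assumption

theorem mono (hC : C' ⊆ C) (h : FlipTour G C M M' m P) : FlipTour G C' M M' m P := by
  induction h with
  | nil h hv hM => exact .nil h hv (hC.trans hM)
  | cons hv hM hf _ ih => exact .cons hv (hC.trans hM) hf ih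

theorem append (h : FlipTour G C M M' m P) (h' : FlipTour G C M' M'' m' P') :
    ∃ Q, P ∪ P' ⊆ Q ∧ FlipTour G C M M'' (m' + m) Q := by
  induction h with
  | nil h hv hM =>
    refine ⟨P', ?_, h'⟩
    refine Set.union_subset ?_ subset_rfl
    rintro x rfl
    cases h' with
    | nil _ hv' => exact h.isolated_unique hv hv'
    | cons hv' => exact Or.inl (h.isolated_unique hv hv')
  | cons hv hM hf _ ih =>
    obtain ⟨Q, hQ, hT⟩ := ih h'
    refine ⟨_, ?_, .cons hv hM hf hT⟩
    rw [Set.insert_union]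
    exact Set.insert_subset_insert hQ

theorem hasFlipSequence (h : FlipTour G C M M' m P) : HasFlipSequence G M M' m := by
  induction h with
  | @nil M => exact ⟨fun _ => M, rfl, rfl, by simp⟩
  | @cons M M' M'' v m P hv hM hf _ ih =>
    obtain ⟨s, h0, hm, hs⟩ := ih
    refine ⟨fun i => Nat.casesOn i M s, rfl, hm, ?_⟩
    rintro (_ | i) hi
    · simpa [h0] using hf
    · exact hs i (by omega)

/-- Since `H` is never touched, the whole tour can be replayed after `H` has been switched to `S`.
This is what allows an excursion in the middle of a tour to change the matching permanently. -/
theorem switch (hS : IsSwitch G H S) (hH : H ⊆ C) (hC' : C' ⊆ C \ H)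
    (h : FlipTour G C M M' m P) : FlipTour G C' (M \ H ∪ S) (M' \ H ∪ S) m P := by
  have key : ∀ {M : Set (Sym2 V)}, C ⊆ M → C' ⊆ M \ H ∪ S := fun hM e he =>
    Or.inl ⟨hM (hC' he).1, (hC' he).2⟩
  induction h with
  | nil h hv hM =>
    exact .nil (hS.isOddMatching h (hH.trans hM)) ((hS.isolated_iff (hH.trans hM)).2 hv) (key hM)
  | cons hv hM hf hT ih =>
    exact .cons ((hS.isolated_iff (hH.trans hM)).2 hv) (key hM)
      (hS.isFlip hf (hH.trans hM) (hH.trans hT.subset_left)) ih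

/-- Inserting an excursion that starts and ends at `v` and switches `H` to `S`. -/
theorem insert_excursion (hS : IsSwitch G H S) (hH : H ⊆ C) (hC' : C' ⊆ C \ H)
    (h : FlipTour G C M M' m P) (hv : v ∈ P) (q : ℕ) (Q : Set V)
    (hexc : ∀ M, IsOddMatching G M → Isolated M v → C ⊆ M →
      ∃ Q', Q ⊆ Q' ∧ FlipTour G C' M (M \ H ∪ S) q Q') :
    ∃ P', P ∪ Q ⊆ P' ∧ FlipTour G C' M (M' \ H ∪ S) (m + q) P' := by
  induction h with
  | @nil M v' h hv' hM =>
    obtain rfl : v = v' := hv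
    obtain ⟨Q', hQ, hT⟩ := hexc M h hv' hM
    obtain ⟨R, hR, hT'⟩ := (FlipTour.nil (C := C') h hv' ((hC'.trans Set.sdiff_subset).trans hM)).append hT
    refine ⟨R, (Set.union_subset_union_right _ hQ).trans hR, by simpa using hT'⟩
  | @cons M M₁ M₂ v' m P hv' hM hf hT ih =>
    -- The excursion is made at the first visit to `v`; the rest of the tour is replayed on the
    -- switched matching.
    by_cases hvv : v = v'
    · subst hvv
      obtain ⟨Q', hQ, hT'⟩ := hexc M hf.1 hv' hM
      obtain ⟨R, hR, hT''⟩ := hT'.append (switch hS hH hC' (.cons hv' hM hf hT))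
      refine ⟨R, ?_, hT''⟩
      rw [Set.union_comm]
      exact (Set.union_subset_union_left _ hQ).trans hR
    · obtain ⟨R, hR, hT'⟩ := ih (hv.resolve_left hvv)
      refine ⟨insert v' R, ?_, ?_⟩
      · rw [Set.insert_union]
        exact Set.insert_subset_insert hR
      · rw [Nat.add_right_comm]
        exact FlipTour.cons hv' ((hC'.trans Set.sdiff_subset).trans hM) hf hT'

/-- The tour that slides the isolated vertex and continues. -/
theorem cons_slide (hM : IsOddMatching G M) (hC : C ⊆ M) (hv : Isolated M v) (hvw : G.Adj v w)
    (hwu : s(w, u) ∈ M) (h : FlipTour G C (insert s(v, w) (M \ {s(w, u)})) M' m P) :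
    FlipTour G C M M' (m + 1) (insert v P) :=
  .cons hv hC (hM.isFlip_slide hv hvw hwu) h

/-- A tour can be extended by a visit to a neighbouring untouched edge. -/
theorem insert_edge (h : FlipTour G C M M' m P) (hv : v ∈ P) (hvw : G.Adj v w)
    (hwu : s(w, u) ∈ C) :
    ∃ P', insert u P ⊆ P' ∧ FlipTour G (C \ {s(w, u)}) M M' (m + 2) P' := by
  -- The excursion goes to `u` and straight back, so nothing is switched.
  have hS : IsSwitch G (∅ : Set (Sym2 V)) ∅ := ⟨by simp, by simp, by simp⟩
  have := h.insert_excursion (C' := C \ {s(w, u)}) hS (by simp) (by simp) hv 2 {u} ?_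
  · simpa [Set.union_singleton] using this
  · intro N hN hvN hC
    have hback : insert s(u, w) (insert s(v, w) (N \ {s(w, u)}) \ {s(w, v)}) = N := by
      have h1 : s(v, w) ∉ N := fun h => hvN _ h (by simp)
      rw [Sym2.eq_swap (a := w) (b := v), Set.insert_sdiff_of_mem _ (Set.mem_singleton _),
        Set.sdiff_singleton_eq_self (fun h => h1 h.1), Sym2.eq_swap (a := u) (b := w),
        Set.insert_sdiff_singleton, Set.insert_eq_of_mem (hC hwu)]
    obtain ⟨h1, h2⟩ := hN.slide hvN hvw (hC hwu)
    have hC1 : C \ {s(w, u)} ⊆ N := Set.sdiff_subset.trans hC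
    have hadj : G.Adj u w := (hN.subset_edgeSet (hC hwu) : G.Adj w u).symm
    rw [Set.sdiff_empty, Set.union_empty]
    have hend : FlipTour G (C \ {s(w, u)}) N N 0 {v} := .nil hN hvN hC1
    nth_rewrite 1 [← hback] at hend
    refine ⟨_, ?_, cons_slide hN hC1 hvN hvw (hC hwu) (cons_slide h1 ?_ h2 hadj
      (Or.inl Sym2.eq_swap) hend)⟩
    · simp
    · exact (Set.sdiff_subset_sdiff_left hC).trans (Set.subset_insert _ _)

end FlipTour

/-- An edge of `M'` has an endpoint that `M` covers, and there the edge of `M` is already the only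
edge of `M'`. -/
theorem IsOddMatching.eq_of_subset (hM : IsOddMatching G M) (hM' : IsOddMatching G M')
    (h : M ⊆ M') : M = M' := by
  refine h.antisymm fun e he => ?_
  obtain ⟨v, hv⟩ := hM.exists_isolated
  induction e with | _ x y
  have key : ∀ {x y : V}, s(x, y) ∈ M' → x ≠ v → s(x, y) ∈ M := by
    intro x y hxy hx
    obtain ⟨z, hz⟩ := hM.exists_mate hv hx
    rwa [hM'.mate_unique hxy (h hz)]
  by_cases hx : x = v
  · have hxy : x ≠ y := (hM'.subset_edgeSet he : G.Adj x y).ne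
    rw [Sym2.eq_swap] at he ⊢
    exact key he (fun h => hxy (hx.trans h.symm))
  · exact key he hx

/-- A tour can be extended by a visit that switches an untouched alternating cycle of length
eight. -/
theorem FlipTour.insert_cycle {m : ℕ} {P : Set V} (h : FlipTour G C M M' m P) (hv : v ∈ P)
    {w₀ u₀ w₁ u₁ w₂ u₂ w₃ u₃ : V} (hnd : [w₀, u₀, w₁, u₁, w₂, u₂, w₃, u₃].Nodup)
    (hvw : G.Adj v w₀) (h₀ : G.Adj u₀ w₁) (h₁ : G.Adj u₁ w₂) (h₂ : G.Adj u₂ w₃)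
    (h₃ : G.Adj u₃ w₀)
    (hH : H = {s(w₀, u₀), s(w₁, u₁), s(w₂, u₂), s(w₃, u₃)})
    (hS : S = {s(u₀, w₁), s(u₁, w₂), s(u₂, w₃), s(u₃, w₀)})
    (hHC : H ⊆ C) :
    ∃ P', P ∪ {u₀, u₁, u₂, u₃} ⊆ P' ∧
      FlipTour G (C \ H) M (M' \ H ∪ S) (m + 5) P' := by
  simp only [List.nodup_cons, List.mem_cons, List.not_mem_nil, or_false, not_or,
    List.nodup_nil, and_true, not_false_eq_true] at hnd
  have hsw : IsSwitch G H S := by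
    subst hH hS
    refine ⟨?_, ?_, ?_⟩
    · rintro e (rfl | rfl | rfl | rfl) <;> assumption
    · rintro e (rfl | rfl | rfl | rfl) f (rfl | rfl | rfl | rfl) x hx hx' <;>
        simp only [Sym2.mem_iff] at hx hx' <;> grind
    · intro x
      simp only [Set.mem_insert_iff, Set.mem_singleton_iff, exists_eq_or_imp, exists_eq_left,
        Sym2.mem_iff]
      tauto
  refine h.insert_excursion hsw hHC subset_rfl hv 5 _ fun N hN hvN hCN => ?_
  have hm₀ : s(w₀, u₀) ∈ N := hCN (hHC (by simp [hH]))
  have hm₁ : s(w₁, u₁) ∈ N := hCN (hHC (by simp [hH]))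
  have hm₂ : s(w₂, u₂) ∈ N := hCN (hHC (by simp [hH]))
  have hm₃ : s(w₃, u₃) ∈ N := hCN (hHC (by simp [hH]))
  have hne : ∀ {a b : V}, s(a, b) ∈ N → v ≠ a ∧ v ≠ b := by
    intro a b hab
    have := hvN _ hab
    simpa using this
  have d₀ := hne hm₀
  have d₁ := hne hm₁
  have d₂ := hne hm₂
  have d₃ := hne hm₃
  obtain ⟨o₁, i₁⟩ := hN.slide hvN hvw hm₀
  have k₁ : s(w₁, u₁) ∈ insert s(v, w₀) (N \ {s(w₀, u₀)}) := by
    simp only [Set.mem_insert_iff, Set.mem_sdiff, Set.mem_singleton_iff, Sym2.eq_iff]; grind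
  obtain ⟨o₂, i₂⟩ := o₁.slide i₁ h₀ k₁
  have k₂ : s(w₂, u₂) ∈ insert s(u₀, w₁) (insert s(v, w₀) (N \ {s(w₀, u₀)}) \ {s(w₁, u₁)}) := by
    simp only [Set.mem_insert_iff, Set.mem_sdiff, Set.mem_singleton_iff, Sym2.eq_iff]; grind
  obtain ⟨o₃, i₃⟩ := o₂.slide i₂ h₁ k₂
  have k₃ : s(w₃, u₃) ∈ insert s(u₁, w₂) (insert s(u₀, w₁)
      (insert s(v, w₀) (N \ {s(w₀, u₀)}) \ {s(w₁, u₁)}) \ {s(w₂, u₂)}) := by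
    simp only [Set.mem_insert_iff, Set.mem_sdiff, Set.mem_singleton_iff, Sym2.eq_iff]; grind
  obtain ⟨o₄, i₄⟩ := o₃.slide i₃ h₂ k₃
  -- The first slide matched `w₀` to `v`; the fifth one, from `u₃` across `w₀`, brings the hole home
  -- to `v`.
  have k₄ : s(w₀, v) ∈ insert s(u₂, w₃) (insert s(u₁, w₂) (insert s(u₀, w₁)
      (insert s(v, w₀) (N \ {s(w₀, u₀)}) \ {s(w₁, u₁)}) \ {s(w₂, u₂)}) \ {s(w₃, u₃)}) := by
    simp only [Set.mem_insert_iff, Set.mem_sdiff, Set.mem_singleton_iff, Sym2.eq_iff]; grind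
  obtain ⟨o₅, i₅⟩ := o₄.slide i₄ h₃ k₄
  have hCe : ∀ e ∈ C \ H, e ∈ N ∧ e ≠ s(w₀, u₀) ∧ e ≠ s(w₁, u₁) ∧ e ≠ s(w₂, u₂) ∧
      e ≠ s(w₃, u₃) := by
    rintro e ⟨he, heH⟩
    refine ⟨hCN he, ?_⟩
    subst hH
    simpa using heH
  -- Only one inclusion between the switched matching and the result of the five slides has to be
  -- checked.
  have hfin := (hsw.isOddMatching hN (hHC.trans hCN)).eq_of_subset o₅ (by
    rintro e (⟨he, heH⟩ | he)
    · have hev : e ≠ s(w₀, v) := by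
        rintro rfl
        exact hvN _ he (by simp)
      subst hH
      simp only [Set.mem_insert_iff, Set.mem_singleton_iff, not_or] at heH
      simp only [Set.mem_insert_iff, Set.mem_sdiff, Set.mem_singleton_iff]
      tauto
    · subst hS
      rcases he with rfl | rfl | rfl | rfl <;>
      · simp only [Set.mem_insert_iff, Set.mem_sdiff, Set.mem_singleton_iff, Sym2.eq_iff]
        grind)
  rw [hfin]
  refine ⟨_, ?_, .cons_slide hN (fun e he => (hCe e he).1) hvN hvw hm₀
    (.cons_slide o₁ ?_ i₁ h₀ k₁ (.cons_slide o₂ ?_ i₂ h₁ k₂ (.cons_slide o₃ ?_ i₃ h₂ k₃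
      (.cons_slide o₄ ?_ i₄ h₃ k₄ (.nil o₅ i₅ ?_)))))⟩
  · rintro x (rfl | rfl | rfl | rfl) <;> simp
  · intro e he
    have := hCe e he
    simp only [Set.mem_insert_iff, Set.mem_sdiff, Set.mem_singleton_iff]
    tauto
  · intro e he
    have := hCe e he
    simp only [Set.mem_insert_iff, Set.mem_sdiff, Set.mem_singleton_iff]
    tauto
  · intro e he
    have := hCe e he
    simp only [Set.mem_insert_iff, Set.mem_sdiff, Set.mem_singleton_iff]
    tauto
  · intro e he
    have := hCe e he
    simp only [Set.mem_insert_iff, Set.mem_sdiff, Set.mem_singleton_iff]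
    tauto
  · rw [← hfin]
    exact fun e he => Or.inl ⟨(hCe e he).1, he.2⟩

end Flips

/-! ### Trees grown vertex by vertex -/

/-- `Grown d r W l`: the set `W` arises from `{r}` by repeatedly joining a new point to an old
one, where joining `q` to `p` costs `d p q`, at total cost `l`. -/
inductive Grown {P R : Type*} [AddMonoid R] (d : P → P → R) (r : P) : Set P → R → Prop
  | base : Grown d r {r} 0
  | step {W : Set P} {l : R} {p : P} (q : P) : Grown d r W l → p ∈ W →
      Grown d r (insert q W) (l + d p q)

theorem Grown.root_mem {P R : Type*} [AddMonoid R] {d : P → P → R} {r : P} {W : Set P} {l : R}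
    (h : Grown d r W l) : r ∈ W := by
  induction h with
  | base => rfl
  | step q _ _ ih => exact Or.inr ih

/-! ### The region explored by a flip sequence -/

section Exploration

variable {V : Type*} {G : SimpleGraph V}

/-- The state of the exploration after `i` flips from `M₀` to `M`: `T` is the set of vertices
touched so far and `R` the set of edges removed so far. -/
structure Explored {P : Type*} (col : V → ℕ) (d : P → P → ℕ) (φ : V → P) (M₀ : Set (Sym2 V))
    (v₀ : V) (i : ℕ) (M : Set (Sym2 V)) (v : V) (T : Set V) (R : Set (Sym2 V)) (W : Set P)
    (l : ℕ) : Prop where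
  isolated : Isolated M v
  mem : v ∈ T
  col_le : ∀ x ∈ T, col x ≤ col v₀ + 2 * i
  added : ∀ e ∈ M \ M₀, ∀ x ∈ e, x ∈ T
  removed : ∀ e ∈ R, ∀ x ∈ e, x ∈ T
  missing : M₀ \ M ⊆ R
  mate : ∀ x y, x ∈ T → s(x, y) ∈ M₀ → y ∈ T
  card_removed : R.ncard ≤ i
  card_visited : 2 * l ≤ (R ∪ M \ M₀).ncard
  grown : Grown d (φ v₀) W l
  image : ∀ x ∈ T, φ x ∈ W

/-- The potential `R ∪ M \ M₀` never loses an edge, because whatever leaves `M` enters `R`. If `w`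
is already touched, the region stays the same. Otherwise `s(w, u)` and `s(v, w)` are two edges new
to the potential, which pay for the one step of length at most 1 from `φ v` to `φ w = φ u`. The
bound on columns keeps the hole where partners have the same image. -/
theorem Explored.step [Finite V] {P : Type*} {col : V → ℕ} {d : P → P → ℕ} {φ : V → P}
    {M₀ M M' : Set (Sym2 V)} {v₀ v : V} {i : ℕ} {T : Set V} {R : Set (Sym2 V)} {W : Set P}
    {l X : ℕ} (hcol : ∀ u v, G.Adj u v → col v ≤ col u + 1)
    (hφ : ∀ u v, G.Adj u v → d (φ u) (φ v) ≤ 1)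
    (hmate : ∀ u v, s(u, v) ∈ M₀ → col u < X → col v < X → φ u = φ v)
    (hX : col v₀ + 2 * (i + 1) < X) (hM₀ : IsOddMatching G M₀)
    (h : Explored col d φ M₀ v₀ i M v T R W l) (hf : IsFlip G M M') :
    ∃ v' T' R' W' l', Explored col d φ M₀ v₀ (i + 1) M' v' T' R' W' l' := by
  obtain ⟨v', w, u, hv', hvw, hwu, hu, hM'⟩ := hf.exists_slide
  obtain rfl := hf.1.isolated_unique h.isolated hv'
  have hR' : (insert s(w, u) R).ncard ≤ i + 1 :=
    (Set.ncard_insert_le _ _).trans (by have := h.card_removed; omega)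
  have hmissing : M₀ \ M' ⊆ insert s(w, u) R := by
    rintro e ⟨he, he'⟩
    by_cases hew : e = s(w, u)
    · exact Or.inl hew
    · refine Or.inr (h.missing ⟨he, fun heM => he' ?_⟩)
      rw [hM']
      exact Or.inr ⟨heM, hew⟩
  have hsub : R ∪ M \ M₀ ⊆ insert s(w, u) R ∪ M' \ M₀ := by
    rintro e (he | ⟨he, he'⟩)
    · exact Or.inl (Or.inr he)
    · by_cases hew : e = s(w, u)
      · exact Or.inl (Or.inl hew)
      · refine Or.inr ⟨?_, he'⟩
        rw [hM']
        exact Or.inr ⟨he, hew⟩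
  have hcw : col w ≤ col v₀ + 2 * i + 1 := by
    have := hcol _ _ hvw
    have := h.col_le v h.mem
    omega
  have hcu : col u ≤ col v₀ + 2 * i + 2 := by
    have hadj : G.Adj w u := hf.1.subset_edgeSet hwu
    have := hcol w u hadj
    omega
  by_cases hwT : w ∈ T
  · have huT : u ∈ T := by
      by_cases hmem : s(w, u) ∈ M₀
      · exact h.mate w u hwT hmem
      · exact h.added _ ⟨hwu, hmem⟩ u (by simp)
    refine ⟨u, T, insert s(w, u) R, W, l, hu, huT, ?_, ?_, ?_, hmissing, h.mate, hR', ?_, h.grown,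
      h.image⟩
    · intro x hx
      have := h.col_le x hx
      omega
    · rintro e ⟨he, he'⟩ x hx
      rw [hM'] at he
      rcases he with rfl | he
      · rcases Sym2.mem_iff.1 hx with rfl | rfl
        · exact h.mem
        · exact hwT
      · exact h.added e ⟨he.1, he'⟩ x hx
    · rintro e (rfl | he) x hx
      · rcases Sym2.mem_iff.1 hx with rfl | rfl
        · exact hwT
        · exact huT
      · exact h.removed e he x hx
    · exact h.card_visited.trans (Set.ncard_le_ncard hsub (Set.toFinite _))
  · have hmem : s(w, u) ∈ M₀ := by
      by_contra hmem
      exact hwT (h.added _ ⟨hwu, hmem⟩ w (by simp))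
    have hwφ : φ w = φ u := hmate w u hmem (by omega) (by omega)
    refine ⟨u, insert u (insert w T), insert s(w, u) R, insert (φ w) W, l + d (φ v) (φ w), hu,
      Or.inl rfl, ?_, ?_, ?_, hmissing, ?_, hR', ?_, h.grown.step _ (h.image v h.mem), ?_⟩
    · rintro x (rfl | rfl | hx)
      · omega
      · omega
      · have := h.col_le x hx
        omega
    · rintro e ⟨he, he'⟩ x hx
      rw [hM'] at he
      rcases he with rfl | he
      · rcases Sym2.mem_iff.1 hx with rfl | rfl
        · exact Or.inr (Or.inr h.mem)
        · exact Or.inr (Or.inl rfl)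
      · exact Or.inr (Or.inr (h.added e ⟨he.1, he'⟩ x hx))
    · rintro e (rfl | he) x hx
      · rcases Sym2.mem_iff.1 hx with rfl | rfl
        · exact Or.inr (Or.inl rfl)
        · exact Or.inl rfl
      · exact Or.inr (Or.inr (h.removed e he x hx))
    · rintro x y (rfl | rfl | hx) hxy
      · rw [Sym2.eq_swap] at hmem
        exact Or.inr (Or.inl (hM₀.mate_unique hxy hmem))
      · exact Or.inl (hM₀.mate_unique hxy hmem)
      · exact Or.inr (Or.inr (h.mate x y hx hxy))
    · have hvu : v ≠ u := by
        rintro rfl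
        exact hv' _ hwu (by simp)
      have hne : s(v, w) ≠ s(w, u) := by
        rw [Sym2.eq_swap]
        exact fun h => hvu (Sym2.congr_right.1 h)
      have hvwM : s(v, w) ∉ M₀ := by
        intro hmem'
        rw [Sym2.eq_swap] at hmem'
        exact hvu (hM₀.mate_unique hmem' hmem)
      -- All edges counted so far lie within `T`, whereas both new edges contain the untouched
      -- vertex `w`.
      have hnot : ∀ e, w ∈ e → e ∉ R ∪ M \ M₀ := by
        rintro e hwe (he | he)
        · exact hwT (h.removed e he w hwe)
        · exact hwT (h.added e he w hwe)
      have hsub' : insert s(v, w) (insert s(w, u) (R ∪ M \ M₀)) ⊆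
          insert s(w, u) R ∪ M' \ M₀ := by
        refine Set.insert_subset (Or.inr ⟨?_, hvwM⟩)
          (Set.insert_subset (Or.inl (Or.inl rfl)) hsub)
        rw [hM']
        exact Or.inl rfl
      have hcard := Set.ncard_le_ncard hsub' (Set.toFinite _)
      rw [Set.ncard_insert_of_notMem, Set.ncard_insert_of_notMem (hnot _ (by simp))] at hcard
      · have := h.card_visited
        have := hφ _ _ hvw
        omega
      · rintro (h | h)
        · exact hne h
        · exact hnot _ (by simp) h
    · rintro x (rfl | rfl | hx)
      · exact Or.inl hwφ.symm
      · exact Or.inl rfl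
      · exact Or.inr (h.image x hx)

/-- A flip sequence explores a connected region that contains all edges to be removed; every
explored edge of the initial matching is paid for by two flips, up to the number of new edges. -/
theorem exists_grown_of_flips [Finite V] {P : Type*} {col : V → ℕ} {d : P → P → ℕ} {φ : V → P}
    {s : ℕ → Set (Sym2 V)} {m X : ℕ} {v₀ : V}
    (hcol : ∀ u v, G.Adj u v → col v ≤ col u + 1)
    (hφ : ∀ u v, G.Adj u v → d (φ u) (φ v) ≤ 1)
    (hmate : ∀ u v, s(u, v) ∈ s 0 → col u < X → col v < X → φ u = φ v)
    (hX : col v₀ + 2 * m < X) (h₀ : IsOddMatching G (s 0)) (hv₀ : Isolated (s 0) v₀)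
    (hs : ∀ i < m, IsFlip G (s i) (s (i + 1))) :
    ∃ W l, Grown d (φ v₀) W l ∧ 2 * l ≤ m + (s m \ s 0).ncard ∧
      ∀ e ∈ s 0 \ s m, ∀ x ∈ e, φ x ∈ W := by
  have key : ∀ i ≤ m, ∃ v T R W l, Explored col d φ (s 0) v₀ i (s i) v T R W l := by
    intro i
    induction i with
    | zero =>
      intro _
      refine ⟨v₀, {v₀}, ∅, {φ v₀}, 0, hv₀, rfl, by simp, by simp, by simp, by simp, ?_, by simp,
        by simp, .base, by simp⟩
      rintro x y rfl hxy
      exact absurd (Sym2.mem_mk_left x y) (hv₀ _ hxy)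
    | succ i ih =>
      intro hi
      obtain ⟨v, T, R, W, l, h⟩ := ih (by omega)
      exact h.step hcol hφ hmate (by omega) h₀ (hs i (by omega))
  obtain ⟨v, T, R, W, l, h⟩ := key m le_rfl
  refine ⟨W, l, h.grown, ?_, fun e he x hx => h.image x (h.removed e (h.missing he) x hx)⟩
  have := h.card_visited
  have := h.card_removed
  have := Set.ncard_union_le R (s m \ s 0)
  omega

end Exploration

/-! ### The initial and the target matching -/

section Construction

/-- The block that contains a vertex (above row `0`). -/
def blockOf (p : ℕ × ℕ) : ℕ × ℕ := (p.1 / 4 + 1, (p.2 - 1) / 2 + 1)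

theorem exists_block (x y : ℕ) (hy : 1 ≤ y) : ∃ a b, blockOf (x, y) = (a + 1, b + 1) ∧
    (x = 4 * a ∨ x = 4 * a + 1 ∨ x = 4 * a + 2 ∨ x = 4 * a + 3) ∧
    (y = 2 * b + 1 ∨ y = 2 * b + 2) :=
  ⟨x / 4, (y - 1) / 2, rfl, by omega, by omega⟩

/-- Membership becomes parity arithmetic plus a condition on the block. Positivity of the
coordinates makes the truncated subtractions in `blockCorner` harmless. -/
theorem mem_iUnion_horizontalEdges {Q : Set (ℕ × ℕ)} (hQ : ∀ v ∈ Q, 1 ≤ v.1 ∧ 1 ≤ v.2)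
    (p q : ℕ × ℕ) : s(p, q) ∈ (⋃ v ∈ Q, horizontalEdges v) ↔
      (q = (p.1 + 1, p.2) ∧ p.1 % 2 = 0 ∧ 1 ≤ p.2 ∧ blockOf p ∈ Q) ∨
      (p = (q.1 + 1, q.2) ∧ q.1 % 2 = 0 ∧ 1 ≤ q.2 ∧ blockOf q ∈ Q) := by
  have key : ∀ p : ℕ × ℕ, p.1 % 2 = 0 → 1 ≤ p.2 → blockOf p ∈ Q →
      s(p, (p.1 + 1, p.2)) ∈ ⋃ v ∈ Q, horizontalEdges v := by
    rintro ⟨x, y⟩ h₁ h₂ h₃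
    obtain ⟨a, b, hab, hx, hy⟩ := exists_block x y h₂
    rw [hab] at h₃
    simp only [Set.mem_iUnion]
    refine ⟨_, h₃, ?_⟩
    dsimp only at h₁
    obtain hx | hx : x = 4 * a ∨ x = 4 * a + 2 := by omega
    all_goals
      subst hx
      rcases hy with rfl | rfl <;> simp [horizontalEdges, blockCorner]
  constructor
  · simp only [Set.mem_iUnion]
    rintro ⟨⟨a, b⟩, hv, h⟩
    have hab := hQ _ hv
    have hblk : ∀ x y, x / 4 + 1 = a → (y - 1) / 2 + 1 = b → blockOf (x, y) ∈ Q := by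
      rintro x y rfl rfl
      exact hv
    simp only [horizontalEdges, blockCorner, Set.mem_insert_iff, Set.mem_singleton_iff,
      Sym2.eq_iff] at h hab
    rcases h with (⟨rfl, rfl⟩ | ⟨rfl, rfl⟩) | (⟨rfl, rfl⟩ | ⟨rfl, rfl⟩) | (⟨rfl, rfl⟩ | ⟨rfl, rfl⟩) |
      (⟨rfl, rfl⟩ | ⟨rfl, rfl⟩)
    all_goals first
      | exact Or.inl ⟨rfl, by dsimp only; omega, by dsimp only; omega,
          hblk _ _ (by omega) (by omega)⟩
      | exact Or.inr ⟨rfl, by dsimp only; omega, by dsimp only; omega,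
          hblk _ _ (by omega) (by omega)⟩
  · rintro (⟨rfl, h⟩ | ⟨rfl, h⟩)
    · exact key p h.1 h.2.1 h.2.2
    · rw [Sym2.eq_swap]
      exact key q h.1 h.2.1 h.2.2

/-- The ordered pairs that form the edges of the switched blocks. -/
def SwitchedPair (Q : Set (ℕ × ℕ)) (p q : ℕ × ℕ) : Prop :=
  1 ≤ p.2 ∧ blockOf p ∈ Q ∧ (q = (p.1 + 1, p.2) ∧ p.1 % 4 = 1 ∨
    q = (p.1, p.2 + 1) ∧ p.2 % 2 = 1 ∧ (p.1 % 4 = 0 ∨ p.1 % 4 = 3))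

theorem mem_iUnion_switchedEdges {Q : Set (ℕ × ℕ)} (hQ : ∀ v ∈ Q, 1 ≤ v.1 ∧ 1 ≤ v.2)
    (p q : ℕ × ℕ) : s(p, q) ∈ (⋃ v ∈ Q, switchedEdges v) ↔
      SwitchedPair Q p q ∨ SwitchedPair Q q p := by
  have key : ∀ p q : ℕ × ℕ, SwitchedPair Q p q → s(p, q) ∈ ⋃ v ∈ Q, switchedEdges v := by
    rintro ⟨x, y⟩ q ⟨h₁, h₂, h₃⟩
    obtain ⟨a, b, hab, hx, hy⟩ := exists_block x y h₁
    rw [hab] at h₂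
    simp only [Set.mem_iUnion]
    refine ⟨_, h₂, ?_⟩
    dsimp only at h₃
    rcases h₃ with ⟨rfl, h₃⟩ | ⟨rfl, h₃, h₄⟩
    · obtain rfl : x = 4 * a + 1 := by omega
      rcases hy with rfl | rfl <;> simp [switchedEdges, blockCorner]
    · obtain rfl : y = 2 * b + 1 := by omega
      obtain hx | hx : x = 4 * a ∨ x = 4 * a + 3 := by omega
      all_goals
        subst hx
        simp [switchedEdges, blockCorner]
  constructor
  · simp only [Set.mem_iUnion]
    rintro ⟨⟨a, b⟩, hv, h⟩
    have hab := hQ _ hv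
    have hblk : ∀ x y, x / 4 + 1 = a → (y - 1) / 2 + 1 = b → blockOf (x, y) ∈ Q := by
      rintro x y rfl rfl
      exact hv
    simp only [switchedEdges, blockCorner, Set.mem_insert_iff, Set.mem_singleton_iff,
      Sym2.eq_iff] at h hab
    rcases h with (⟨rfl, rfl⟩ | ⟨rfl, rfl⟩) | (⟨rfl, rfl⟩ | ⟨rfl, rfl⟩) | (⟨rfl, rfl⟩ | ⟨rfl, rfl⟩) |
      (⟨rfl, rfl⟩ | ⟨rfl, rfl⟩)
    all_goals first
      | exact Or.inl ⟨by dsimp only; omega, hblk _ _ (by omega) (by omega),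
          Or.inl ⟨rfl, by dsimp only; omega⟩⟩
      | exact Or.inl ⟨by dsimp only; omega, hblk _ _ (by omega) (by omega),
          Or.inr ⟨rfl, by dsimp only; omega, by dsimp only; omega⟩⟩
      | exact Or.inr ⟨by dsimp only; omega, hblk _ _ (by omega) (by omega),
          Or.inl ⟨rfl, by dsimp only; omega⟩⟩
      | exact Or.inr ⟨by dsimp only; omega, hblk _ _ (by omega) (by omega),
          Or.inr ⟨rfl, by dsimp only; omega, by dsimp only; omega⟩⟩
  · rintro (h | h)
    · exact key p q h
    · rw [Sym2.eq_swap]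
      exact key q p h

variable {n : ℕ} {K : Finset (Fin n × Fin n)} {low : Fin n × Fin n}

theorem refinePoint_mem_refinedGrid (low v : Fin n × Fin n) :
    refinePoint low v ∈ refinedGrid n := by
  have h1 : (v.1 : ℕ) + 1 ≤ n := v.1.2
  have h2 : (v.2 : ℕ) - (low.2 : ℕ) + 1 ≤ n := by have := v.2.2; omega
  have hle : ∀ x, x + 1 ≤ n → 8 * n * x + 1 ≤ refinedSide n := by
    intro x hx
    have : 8 * n * (x + 1) ≤ 8 * n * (n + 4 * n ^ 2) := Nat.mul_le_mul_left _ (by omega)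
    rw [refinedSide]
    rw [mul_add] at this
    omega
  simp only [refinedGrid, refinePoint, Set.mem_ofPred_eq, Set.mem_Icc]
  exact ⟨⟨by omega, hle _ h1⟩, by omega, hle _ h2⟩

theorem refinedTerminals_subset : refinedTerminals K low ⊆ refinedGrid n := by
  rintro _ ⟨v, _, rfl⟩
  exact refinePoint_mem_refinedGrid low v

theorem refinedGrid_pos : ∀ v ∈ refinedGrid n, 1 ≤ v.1 ∧ 1 ≤ v.2 :=
  fun _ hv => ⟨hv.1.1, hv.2.1⟩

theorem holeColumn_eq (low : Fin n × Fin n) : holeColumn low = 32 * n * (low.1 : ℕ) + 2 := by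
  simp only [holeColumn, blockCorner, refinePoint, Nat.add_sub_cancel]
  ring

theorem holeColumn_mod (low : Fin n × Fin n) : holeColumn low % 2 = 0 := by
  have : 32 * n * (low.1 : ℕ) = 2 * (16 * n * (low.1 : ℕ)) := by ring
  rw [holeColumn_eq, this]
  omega

theorem holeColumn_lt (low : Fin n × Fin n) : holeColumn low < 4 * refinedSide n := by
  have := (refinePoint_mem_refinedGrid low low).1.2
  have h1 : 8 * n * (low.1 : ℕ) + 1 ≤ refinedSide n := this
  have h2 : 32 * n * (low.1 : ℕ) = 4 * (8 * n * (low.1 : ℕ)) := by ring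
  rw [holeColumn_eq]
  omega

/-- The ordered pairs that form the edges of the initial matching; `c` is the column of the
isolated vertex. -/
def InitialPair (c N : ℕ) (p q : ℕ × ℕ) : Prop :=
  q.2 = p.2 ∧ q.1 = p.1 + 1 ∧
      (p.2 = 0 ∧ (p.1 % 2 = 0 ∧ p.1 + 1 < c ∨ p.1 % 2 = 1 ∧ c < p.1 ∧ p.1 + 1 ≤ 4 * N) ∨
        1 ≤ p.2 ∧ p.2 ≤ 2 * N ∧ p.1 % 2 = 0 ∧ p.1 < 4 * N) ∨
    q.1 = p.1 ∧ p.1 = 4 * N ∧ q.2 = p.2 + 1 ∧ p.2 % 2 = 1 ∧ p.2 < 2 * N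

theorem mem_borderEdges (p q : ℕ × ℕ) : s(p, q) ∈ borderEdges low ↔
    (InitialPair (holeColumn low) (refinedSide n) p q ∧ (p.2 = 0 ∨ p.1 = 4 * refinedSide n)) ∨
    (InitialPair (holeColumn low) (refinedSide n) q p ∧ (q.2 = 0 ∨ q.1 = 4 * refinedSide n)) := by
  have hc := holeColumn_mod low
  have hc' := holeColumn_lt low
  have key : ∀ p q : ℕ × ℕ, InitialPair (holeColumn low) (refinedSide n) p q →
      (p.2 = 0 ∨ p.1 = 4 * refinedSide n) → s(p, q) ∈ borderEdges low := by
    rintro ⟨x, y⟩ ⟨x', y'⟩ h h'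
    rcases h with ⟨h₁, h₂, h₃⟩ | ⟨h₁, h₂, h₃, h₄, h₅⟩
    · dsimp only at *
      subst h₁ h₂
      obtain rfl : y' = 0 := by omega
      by_cases hx : x < holeColumn low
      · obtain ⟨i, rfl⟩ : ∃ i, x = 2 * i := ⟨x / 2, by omega⟩
        exact Or.inl (Or.inl ⟨i, by omega, rfl⟩)
      · obtain ⟨i, rfl⟩ : ∃ i, x = holeColumn low + 2 * i + 1 :=
          ⟨(x - holeColumn low) / 2, by omega⟩
        exact Or.inl (Or.inr ⟨i, by omega, rfl⟩)
    · dsimp only at *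
      obtain ⟨j, rfl⟩ : ∃ j, y = 2 * j + 1 := ⟨y / 2, by omega⟩
      subst h₁ h₂ h₃
      exact Or.inr ⟨j, by omega, rfl⟩
  constructor
  · obtain ⟨x, y⟩ := p
    obtain ⟨x', y'⟩ := q
    rintro ((⟨i, h, h'⟩ | ⟨i, h, h'⟩) | ⟨i, h, h'⟩)
    all_goals
      simp only [Sym2.eq_iff, Prod.mk.injEq] at h'
      rcases h' with h' | h'
      · refine Or.inl ?_
        simp only [InitialPair]
        omega
      · refine Or.inr ?_
        simp only [InitialPair]
        omega
  · rintro (h | h)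
    · exact key p q h.1 h.2
    · rw [Sym2.eq_swap]
      exact key q p h.1 h.2

theorem blockMatching_horizontalEdges :
    blockMatching K low horizontalEdges =
      borderEdges low ∪ ⋃ v ∈ refinedGrid n, horizontalEdges v := by
  rw [blockMatching, Set.union_assoc, ← Set.biUnion_union,
    Set.sdiff_union_of_subset refinedTerminals_subset]

theorem mem_blockMatching_horizontalEdges (p q : ℕ × ℕ) :
    s(p, q) ∈ blockMatching K low horizontalEdges ↔
      InitialPair (holeColumn low) (refinedSide n) p q ∨
      InitialPair (holeColumn low) (refinedSide n) q p := by
  rw [blockMatching_horizontalEdges, Set.mem_union, mem_borderEdges,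
    mem_iUnion_horizontalEdges refinedGrid_pos]
  have key : ∀ p q : ℕ × ℕ, InitialPair (holeColumn low) (refinedSide n) p q ↔
      (InitialPair (holeColumn low) (refinedSide n) p q ∧
        (p.2 = 0 ∨ p.1 = 4 * refinedSide n)) ∨
      (q = (p.1 + 1, p.2) ∧ p.1 % 2 = 0 ∧ 1 ≤ p.2 ∧ blockOf p ∈ refinedGrid n) := by
    rintro ⟨x, y⟩ ⟨x', y'⟩
    constructor
    · intro h
      by_cases hxy : y = 0 ∨ x = 4 * refinedSide n
      · exact Or.inl ⟨h, hxy⟩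
      · obtain ⟨h₁, h₂, h₃ | h₃⟩ | h := h
        · exact absurd (Or.inl h₃.1) hxy
        · simp only at h₁ h₂ h₃
          refine Or.inr ⟨Prod.ext h₂ h₁, h₃.2.2.1, h₃.1, ?_⟩
          simp only [blockOf, refinedGrid, Set.mem_ofPred_eq, Set.mem_Icc]
          omega
        · exact absurd (Or.inr h.2.1) hxy
    · rintro (h | ⟨h₁, h₂, h₃, h₄⟩)
      · exact h.1
      · simp only [blockOf, refinedGrid, Set.mem_ofPred_eq, Set.mem_Icc, Prod.mk.injEq] at *
        exact Or.inl ⟨h₁.2, h₁.1, Or.inr ⟨h₃, by dsimp only; omega, h₂, by dsimp only; omega⟩⟩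
  constructor
  · rintro ((h | h) | h | h)
    · exact Or.inl ((key p q).2 (Or.inl h))
    · exact Or.inr ((key q p).2 (Or.inl h))
    · exact Or.inl ((key p q).2 (Or.inr h))
    · exact Or.inr ((key q p).2 (Or.inr h))
  · rintro (h | h)
    · exact ((key p q).1 h).imp Or.inl Or.inl
    · exact ((key q p).1 h).imp Or.inr Or.inr

/-- The natural coordinates of a vertex of a grid. -/
def coords {w h : ℕ} (p : Fin w × Fin h) : ℕ × ℕ := (p.1, p.2)

theorem coords_injective {w h : ℕ} : Function.Injective (coords : Fin w × Fin h → ℕ × ℕ) := by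
  rintro ⟨a, b⟩ ⟨a', b'⟩ h
  simpa [coords, Fin.ext_iff] using h

theorem gridGraph_adj {w h : ℕ} {p q : Fin w × Fin h} : (gridGraph w h).Adj p q ↔
    ((coords p).2 = (coords q).2 ∧
      ((coords p).1 + 1 = (coords q).1 ∨ (coords q).1 + 1 = (coords p).1)) ∨
    ((coords p).1 = (coords q).1 ∧
      ((coords p).2 + 1 = (coords q).2 ∨ (coords q).2 + 1 = (coords p).2)) := by
  simp only [gridGraph, SimpleGraph.boxProd_adj, SimpleGraph.pathGraph_adj, coords, Fin.ext_iff]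
  tauto

/-- The vertex of the reduction graph with given coordinates. -/
def gridVertex (n : ℕ) (p : ℕ × ℕ) :
    Fin (4 * refinedSide n + 1) × Fin (2 * refinedSide n + 1) :=
  (Fin.ofNat _ p.1, Fin.ofNat _ p.2)

theorem coords_gridVertex {p : ℕ × ℕ} (h₁ : p.1 ≤ 4 * refinedSide n)
    (h₂ : p.2 ≤ 2 * refinedSide n) : coords (gridVertex n p) = p := by
  simp [coords, gridVertex, Nat.mod_eq_of_lt (Nat.lt_succ_of_le h₁),
    Nat.mod_eq_of_lt (Nat.lt_succ_of_le h₂)]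

theorem coords_le (p : Fin (4 * refinedSide n + 1) × Fin (2 * refinedSide n + 1)) :
    (coords p).1 ≤ 4 * refinedSide n ∧ (coords p).2 ≤ 2 * refinedSide n :=
  ⟨Nat.le_of_lt_succ p.1.2, Nat.le_of_lt_succ p.2.2⟩

theorem mem_initialMatching
    {p q : Fin (4 * refinedSide n + 1) × Fin (2 * refinedSide n + 1)} :
    s(p, q) ∈ initialMatching K low ↔
      InitialPair (holeColumn low) (refinedSide n) (coords p) (coords q) ∨
      InitialPair (holeColumn low) (refinedSide n) (coords q) (coords p) :=
  mem_blockMatching_horizontalEdges _ _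

theorem isolated_initialMatching :
    Isolated (initialMatching K low) (gridVertex n (holeColumn low, 0)) := by
  rintro e he ⟨q, rfl⟩
  rw [mem_initialMatching,
    coords_gridVertex (p := (holeColumn low, 0)) (holeColumn_lt low).le (by simp)] at he
  have := holeColumn_mod low
  have := holeColumn_lt low
  simp only [InitialPair] at he
  omega

/-- Disjointness is arithmetic on `InitialPair`. For covering, the partner of each vertex other than
the hole is given explicitly: above or below in the last column above row 0, left or right
elsewhere, by parity and the side of the hole. -/
theorem isOddMatching_initialMatching :
    IsOddMatching (reductionGraph n) (initialMatching K low) := by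
  have hc := holeColumn_mod low
  have hc' := holeColumn_lt low
  refine ⟨?_, ?_, gridVertex n (holeColumn low, 0), isolated_initialMatching, ?_⟩
  · intro e he
    induction e with | _ p q
    rw [mem_initialMatching] at he
    rw [SimpleGraph.mem_edgeSet, gridGraph_adj]
    simp only [InitialPair] at he
    omega
  · rintro _ he _ hf v ⟨a, rfl⟩ ⟨b, rfl⟩
    rw [mem_initialMatching] at he hf
    simp only [InitialPair] at he hf
    rw [Sym2.congr_right]
    apply coords_injective
    apply Prod.ext <;> omega
  · intro p hp
    by_contra hne
    have hb := coords_le p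
    have hne' : coords p ≠ (holeColumn low, 0) := by
      intro h
      apply hne
      apply coords_injective
      rw [h, coords_gridVertex (p := (holeColumn low, 0)) hc'.le (by simp)]
    suffices h : ∃ q : ℕ × ℕ, q.1 ≤ 4 * refinedSide n ∧ q.2 ≤ 2 * refinedSide n ∧
        (InitialPair (holeColumn low) (refinedSide n) (coords p) q ∨
          InitialPair (holeColumn low) (refinedSide n) q (coords p)) by
      obtain ⟨q, h₁, h₂, h⟩ := h
      refine hp s(p, gridVertex n q) ?_ (Sym2.mem_mk_left _ _)
      rwa [mem_initialMatching, coords_gridVertex h₁ h₂]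
    clear hp hne
    generalize coords p = z at hb hne' ⊢
    clear p
    obtain ⟨x, y⟩ := z
    simp only [InitialPair, ne_eq, Prod.mk.injEq] at *
    generalize holeColumn low = c at *
    generalize refinedSide n = N at *
    by_cases h1 : y ≠ 0 ∧ x = 4 * N
    · by_cases h2 : y % 2 = 1
      · exact ⟨(x, y + 1), hb.1, by dsimp only; omega, Or.inl (Or.inr ⟨rfl, h1.2, rfl, h2,
          by omega⟩)⟩
      · exact ⟨(x, y - 1), hb.1, by dsimp only; omega, Or.inr (Or.inr ⟨rfl, h1.2,
          by dsimp only; omega, by dsimp only; omega, by dsimp only; omega⟩)⟩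
    · by_cases h2 : x % 2 = 0 ∧ (y ≠ 0 ∨ x < c) ∨ x % 2 = 1 ∧ y = 0 ∧ c < x
      · exact ⟨(x + 1, y), by dsimp only; omega, hb.2, Or.inl (Or.inl ⟨rfl, rfl, by omega⟩)⟩
      · exact ⟨(x - 1, y), by dsimp only; omega, hb.2,
          Or.inr (Or.inl ⟨rfl, by dsimp only; omega, by dsimp only; omega⟩)⟩

end Construction

/-! ### Switching blocks of the initial matching. -/

section Switching

variable {n : ℕ} {K : Finset (Fin n × Fin n)} {low : Fin n × Fin n} {Q : Set (ℕ × ℕ)}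

/-- The horizontal edges of the blocks in `Q`. -/
def hEdges (n : ℕ) (Q : Set (ℕ × ℕ)) :
    Set (Sym2 (Fin (4 * refinedSide n + 1) × Fin (2 * refinedSide n + 1))) :=
  inGrid _ _ (⋃ v ∈ Q, horizontalEdges v)

/-- The switched edges of the blocks in `Q`. -/
def sEdges (n : ℕ) (Q : Set (ℕ × ℕ)) :
    Set (Sym2 (Fin (4 * refinedSide n + 1) × Fin (2 * refinedSide n + 1))) :=
  inGrid _ _ (⋃ v ∈ Q, switchedEdges v)

theorem mem_hEdges (hQ : Q ⊆ refinedGrid n)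
    {p q : Fin (4 * refinedSide n + 1) × Fin (2 * refinedSide n + 1)} :
    s(p, q) ∈ hEdges n Q ↔
      (coords q = ((coords p).1 + 1, (coords p).2) ∧ (coords p).1 % 2 = 0 ∧ 1 ≤ (coords p).2 ∧
        blockOf (coords p) ∈ Q) ∨
      (coords p = ((coords q).1 + 1, (coords q).2) ∧ (coords q).1 % 2 = 0 ∧ 1 ≤ (coords q).2 ∧
        blockOf (coords q) ∈ Q) :=
  mem_iUnion_horizontalEdges (fun v hv => refinedGrid_pos v (hQ hv)) _ _

theorem mem_sEdges (hQ : Q ⊆ refinedGrid n)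
    {p q : Fin (4 * refinedSide n + 1) × Fin (2 * refinedSide n + 1)} :
    s(p, q) ∈ sEdges n Q ↔
      SwitchedPair Q (coords p) (coords q) ∨ SwitchedPair Q (coords q) (coords p) :=
  mem_iUnion_switchedEdges (fun v hv => refinedGrid_pos v (hQ hv)) _ _

theorem hEdges_subset (hQ : Q ⊆ refinedGrid n) : hEdges n Q ⊆ initialMatching K low := by
  rw [initialMatching, blockMatching_horizontalEdges]
  exact fun e he => Or.inr (Set.biUnion_subset_biUnion_left hQ he)

theorem blockOf_bounds {p : ℕ × ℕ} (hQ : Q ⊆ refinedGrid n) (hp : blockOf p ∈ Q) :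
    p.1 < 4 * refinedSide n ∧ p.2 ≤ 2 * refinedSide n := by
  have := hQ hp
  simp only [blockOf, refinedGrid, Set.mem_ofPred_eq, Set.mem_Icc] at this
  omega

theorem cover_hEdges (hQ : Q ⊆ refinedGrid n)
    (p : Fin (4 * refinedSide n + 1) × Fin (2 * refinedSide n + 1)) :
    (∃ e ∈ hEdges n Q, p ∈ e) ↔ 1 ≤ (coords p).2 ∧ blockOf (coords p) ∈ Q := by
  constructor
  · rintro ⟨_, he, q, rfl⟩
    rcases (mem_hEdges hQ).1 he with ⟨_, _, h₁, h₂⟩ | ⟨h, h₃, h₁, h₂⟩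
    · exact ⟨h₁, h₂⟩
    · rw [h]
      refine ⟨h₁, ?_⟩
      convert h₂ using 1
      apply Prod.ext <;> (simp only [blockOf]; try omega)
  · rintro ⟨h₁, h₂⟩
    have hb := blockOf_bounds hQ h₂
    by_cases hx : (coords p).1 % 2 = 0
    · refine ⟨s(p, gridVertex n ((coords p).1 + 1, (coords p).2)), ?_, by simp⟩
      rw [mem_hEdges hQ, coords_gridVertex (p := ((coords p).1 + 1, (coords p).2)) (by simp only; omega)
        hb.2]
      exact Or.inl ⟨rfl, hx, h₁, h₂⟩
    · refine ⟨s(p, gridVertex n ((coords p).1 - 1, (coords p).2)), ?_, by simp⟩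
      rw [mem_hEdges hQ, coords_gridVertex (p := ((coords p).1 - 1, (coords p).2)) (by simp only; omega)
        hb.2]
      refine Or.inr ⟨Prod.ext (by simp only; omega) rfl, by simp only; omega, h₁, ?_⟩
      convert h₂ using 1
      apply Prod.ext <;> (simp only [blockOf]; try omega)

theorem SwitchedPair.right {p q : ℕ × ℕ} (h : SwitchedPair Q p q) :
    1 ≤ q.2 ∧ blockOf q ∈ Q := by
  obtain ⟨h₁, h₂, ⟨rfl, h₃⟩ | ⟨rfl, h₃⟩⟩ := h
  all_goals
    refine ⟨by simp only; omega, ?_⟩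
    convert h₂ using 1
    apply Prod.ext <;> (simp only [blockOf]; try omega)

theorem cover_sEdges (hQ : Q ⊆ refinedGrid n)
    (p : Fin (4 * refinedSide n + 1) × Fin (2 * refinedSide n + 1)) :
    (∃ e ∈ sEdges n Q, p ∈ e) ↔ 1 ≤ (coords p).2 ∧ blockOf (coords p) ∈ Q := by
  constructor
  · rintro ⟨_, he, q, rfl⟩
    rcases (mem_sEdges hQ).1 he with h | h
    · exact ⟨h.1, h.2.1⟩
    · exact h.right
  · rintro ⟨h₁, h₂⟩
    have hb := blockOf_bounds hQ h₂
    have hb' := hQ h₂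
    simp only [blockOf, refinedGrid, Set.mem_ofPred_eq, Set.mem_Icc] at hb'
    suffices h : ∃ q : ℕ × ℕ, q.1 ≤ 4 * refinedSide n ∧ q.2 ≤ 2 * refinedSide n ∧
        (SwitchedPair Q (coords p) q ∨ SwitchedPair Q q (coords p)) by
      obtain ⟨q, k₁, k₂, h⟩ := h
      refine ⟨s(p, gridVertex n q), ?_, by simp⟩
      rwa [mem_sEdges hQ, coords_gridVertex k₁ k₂]
    generalize coords p = z at *
    obtain ⟨x, y⟩ := z
    simp only at *
    obtain hx | hx | hx : x % 4 = 1 ∨ x % 4 = 2 ∨ (x % 4 = 0 ∨ x % 4 = 3) := by omega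
    · exact ⟨(x + 1, y), by simp only; omega, hb.2, Or.inl ⟨h₁, h₂, Or.inl ⟨rfl, hx⟩⟩⟩
    · refine ⟨(x - 1, y), by simp only; omega, hb.2, Or.inr ⟨h₁, ?_,
        Or.inl ⟨Prod.ext (by simp only; omega) rfl, by simp only; omega⟩⟩⟩
      convert h₂ using 1
      apply Prod.ext <;> (simp only [blockOf]; try omega)
    · by_cases hy : y % 2 = 1
      · exact ⟨(x, y + 1), by simp only; omega, by simp only; omega,
          Or.inl ⟨h₁, h₂, Or.inr ⟨rfl, hy, hx⟩⟩⟩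
      · refine ⟨(x, y - 1), by simp only; omega, by simp only; omega, Or.inr ⟨by simp only; omega,
          ?_, Or.inr ⟨Prod.ext rfl (by simp only; omega), by simp only; omega, hx⟩⟩⟩
        convert h₂ using 1
        apply Prod.ext <;> (simp only [blockOf]; try omega)

theorem SwitchedPair.cases {p q : ℕ × ℕ} (h : SwitchedPair Q p q) :
    q.1 = p.1 + 1 ∧ q.2 = p.2 ∧ p.1 % 4 = 1 ∨
      q.1 = p.1 ∧ q.2 = p.2 + 1 ∧ p.2 % 2 = 1 ∧ (p.1 % 4 = 0 ∨ p.1 % 4 = 3) := by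
  obtain ⟨-, -, ⟨rfl, h₃⟩ | ⟨rfl, h₃⟩⟩ := h
  · exact Or.inl ⟨rfl, rfl, h₃⟩
  · exact Or.inr ⟨rfl, rfl, h₃⟩

/-- Both families perfectly match exactly the vertices of the blocks in `Q`, being the two
alternating halves of the 8-cycles. -/
theorem isSwitch_blocks (hQ : Q ⊆ refinedGrid n) :
    IsSwitch (reductionGraph n) (hEdges n Q) (sEdges n Q) := by
  refine ⟨?_, ?_, fun p => by rw [cover_hEdges hQ, cover_sEdges hQ]⟩
  · intro e he
    induction e with | _ p q
    rw [SimpleGraph.mem_edgeSet, gridGraph_adj]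
    rcases (mem_sEdges hQ).1 he with h | h
    all_goals
      have := h.cases
      omega
  · rintro _ he _ hf v ⟨a, rfl⟩ ⟨b, rfl⟩
    rw [Sym2.congr_right]
    apply coords_injective
    rcases (mem_sEdges hQ).1 he with he | he <;> rcases (mem_sEdges hQ).1 hf with hf | hf
    all_goals
      have := he.cases
      have := hf.cases
      apply Prod.ext <;> omega

theorem sEdges_disjoint_hEdges {Q' : Set (ℕ × ℕ)} (hQ : Q ⊆ refinedGrid n)
    (hQ' : Q' ⊆ refinedGrid n) :
    Disjoint (sEdges n Q) (hEdges n Q') := by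
  rw [Set.disjoint_left]
  intro e he he'
  induction e with | _ p q
  rcases (mem_sEdges hQ).1 he with h | h <;> rcases (mem_hEdges hQ').1 he' with h' | h'
  all_goals
    have := h.cases
    have := congrArg Prod.fst h'.1
    have := congrArg Prod.snd h'.1
    simp only at *
    omega

/-- The initial matching with the blocks in `Q` switched. -/
def switchedMatching (K : Finset (Fin n × Fin n)) (low : Fin n × Fin n) (Q : Set (ℕ × ℕ)) :
    Set (Sym2 (Fin (4 * refinedSide n + 1) × Fin (2 * refinedSide n + 1))) :=
  initialMatching K low \ hEdges n Q ∪ sEdges n Q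

theorem switchedMatching_empty : switchedMatching K low ∅ = initialMatching K low := by
  simp [switchedMatching, hEdges, sEdges, inGrid]

/-- Blocks can be switched one at a time, as removing the horizontal edges of `t` spares all
switched edges inserted before. -/
theorem switchedMatching_insert {t : ℕ × ℕ} (hQ : Q ⊆ refinedGrid n) (ht : t ∈ refinedGrid n) :
    switchedMatching K low (insert t Q) =
      switchedMatching K low Q \ hEdges n {t} ∪ sEdges n {t} := by
  have h₁ : hEdges n (insert t Q) = hEdges n {t} ∪ hEdges n Q := by
    simp only [hEdges, Set.biUnion_insert, Set.biUnion_singleton]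
    rfl
  have h₂ : sEdges n (insert t Q) = sEdges n {t} ∪ sEdges n Q := by
    simp only [sEdges, Set.biUnion_insert, Set.biUnion_singleton]
    rfl
  have hd : sEdges n Q \ hEdges n {t} = sEdges n Q :=
    (sEdges_disjoint_hEdges hQ (by simpa using ht)).sdiff_eq_left
  rw [switchedMatching, switchedMatching, h₁, h₂, Set.union_sdiff_distrib, hd, Set.sdiff_sdiff,
    Set.union_comm (hEdges n Q), Set.union_assoc, Set.union_comm (sEdges n {t})]

theorem switchedMatching_refinedTerminals :
    switchedMatching K low (refinedTerminals K low) = targetMatching K low := by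
  have hT : refinedTerminals K low ⊆ refinedGrid n := refinedTerminals_subset
  have hpos : ∀ v ∈ refinedTerminals K low, 1 ≤ v.1 ∧ 1 ≤ v.2 :=
    fun v hv => refinedGrid_pos v (hT hv)
  have hd : Disjoint (borderEdges low ∪
      ⋃ v ∈ refinedGrid n \ refinedTerminals K low, horizontalEdges v)
      (⋃ v ∈ refinedTerminals K low, horizontalEdges v) := by
    rw [Set.disjoint_left]
    intro e he he'
    induction e with | _ p q
    rw [mem_iUnion_horizontalEdges hpos] at he'
    rcases he with he | he
    · rw [mem_borderEdges] at he
      rcases he' with ⟨rfl, h₁, h₂, h₃⟩ | ⟨rfl, h₁, h₂, h₃⟩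
      all_goals
        have := blockOf_bounds hT h₃
        simp only [InitialPair] at he
        omega
    · rw [mem_iUnion_horizontalEdges fun v hv => refinedGrid_pos v hv.1] at he
      rcases he with he | he <;> rcases he' with he' | he'
      · exact he.2.2.2.2 he'.2.2.2
      · have := congrArg Prod.fst he.1
        have := congrArg Prod.fst he'.1
        simp only at *
        omega
      · have := congrArg Prod.fst he.1
        have := congrArg Prod.fst he'.1
        simp only at *
        omega
      · exact he.2.2.2.2 he'.2.2.2
  have hset : blockMatching K low horizontalEdges \
      (⋃ v ∈ refinedTerminals K low, horizontalEdges v) ∪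
      (⋃ v ∈ refinedTerminals K low, switchedEdges v) = blockMatching K low switchedEdges := by
    rw [blockMatching, blockMatching, Set.union_sdiff_cancel_right hd.le_bot]
  rw [targetMatching, ← hset]
  rfl

theorem isOddMatching_targetMatching :
    IsOddMatching (reductionGraph n) (targetMatching K low) := by
  rw [← switchedMatching_refinedTerminals]
  exact (isSwitch_blocks refinedTerminals_subset).isOddMatching isOddMatching_initialMatching
    (hEdges_subset refinedTerminals_subset)

/-- New edges occur only in the terminal blocks, four in each. This is the additive error when a
flip sequence is turned into a tree. -/
theorem ncard_targetMatching_sdiff_le :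
    (targetMatching K low \ initialMatching K low).ncard ≤ 4 * K.card := by
  classical
  have hinj : Function.Injective (Sym2.map
      (coords : Fin (4 * refinedSide n + 1) × Fin (2 * refinedSide n + 1) → ℕ × ℕ)) :=
    Sym2.map.injective coords_injective
  let F : Fin n × Fin n → Finset (Sym2 (ℕ × ℕ)) := fun v =>
    let x := (blockCorner (refinePoint low v)).1
    let y := (blockCorner (refinePoint low v)).2
    {s((x, y), (x, y + 1)), s((x + 1, y), (x + 2, y)),
      s((x + 1, y + 1), (x + 2, y + 1)), s((x + 3, y), (x + 3, y + 1))}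
  have hF : (K.biUnion F).card ≤ 4 * K.card := by
    rw [mul_comm]
    exact Finset.card_biUnion_le_card_mul _ _ _ fun v _ => Finset.card_le_four
  refine le_trans ?_ hF
  rw [← Set.ncard_coe_finset, ← Set.ncard_image_of_injective _ hinj]
  refine Set.ncard_le_ncard ?_ (Finset.finite_toSet _)
  rintro _ ⟨e, ⟨he, he'⟩, rfl⟩
  rw [← switchedMatching_refinedTerminals] at he
  rcases he with he | he
  · exact absurd he.1 he'
  · have he₂ : Sym2.map coords e ∈ ⋃ v ∈ refinedTerminals K low, switchedEdges v := he
    simp only [Set.mem_iUnion] at he₂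
    obtain ⟨_, ⟨v, hv, rfl⟩, he₂⟩ := he₂
    rw [Finset.mem_coe, Finset.mem_biUnion]
    refine ⟨v, hv, ?_⟩
    simpa [F, switchedEdges] using he₂

end Switching

/-! ### Sets spread along the arcs of a relation -/

/-- `Spread arc r D`: the finite set `D` arises from `{r}` by repeatedly following arcs. -/
inductive Spread {P : Type*} [DecidableEq P] (arc : P → P → Prop) (r : P) : Finset P → Prop
  | base : Spread arc r {r}
  | step {D : Finset P} {a b : P} : Spread arc r D → a ∈ D → arc a b → Spread arc r (insert b D)

theorem Spread.root_mem {P : Type*} [DecidableEq P] {arc : P → P → Prop} {r : P} {D : Finset P}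
    (h : Spread arc r D) : r ∈ D := by
  induction h with
  | base => simp
  | step _ _ _ ih => exact Finset.mem_insert_of_mem ih

/-- Following a path of `t` arcs. -/
theorem Spread.path {P : Type*} [DecidableEq P] {arc : P → P → Prop} {r : P} {D : Finset P}
    (h : Spread arc r D) (f : ℕ → P) (t : ℕ) (h0 : f 0 ∈ D)
    (hf : ∀ i < t, arc (f i) (f (i + 1))) :
    ∃ D', Spread arc r D' ∧ D ⊆ D' ∧ D'.card ≤ D.card + t ∧ f t ∈ D' := by
  induction t with
  | zero => exact ⟨D, h, subset_rfl, le_rfl, h0⟩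
  | succ t ih =>
    obtain ⟨D', h₁, h₂, h₃, h₄⟩ := ih fun i hi => hf i (by omega)
    refine ⟨insert (f (t + 1)) D', h₁.step h₄ (hf t (by omega)),
      h₂.trans (Finset.subset_insert _ _), ?_, by simp⟩
    have := Finset.card_insert_le (f (t + 1)) D'
    omega

/-! ### Dimers -/

section Dimers

variable {n : ℕ} {K : Finset (Fin n × Fin n)} {low : Fin n × Fin n}

/-- The dimer `(i, r)` consists of the vertices in columns `2 i` and `2 i + 1` of row `r`. -/
def ValidDimer (n : ℕ) (d : ℕ × ℕ) : Prop :=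
  d.1 < 2 * refinedSide n ∧ 1 ≤ d.2 ∧ d.2 ≤ 2 * refinedSide n

/-- The vertex through which the isolated vertex enters a dimer. -/
def entry (d : ℕ × ℕ) : ℕ × ℕ := (2 * d.1 + (d.2 + 1) % 2, d.2)

/-- The position of the isolated vertex after entering a dimer. -/
def leave (d : ℕ × ℕ) : ℕ × ℕ := (2 * d.1 + d.2 % 2, d.2)

/-- The isolated vertex can be moved from `a` to `b` if both are in their initial position. -/
def DimerArc (n : ℕ) (a b : ℕ × ℕ) : Prop :=
  ValidDimer n b ∧ ((b.2 = a.2 ∧ (a.2 % 2 = 1 ∧ b.1 = a.1 + 1 ∨ a.2 % 2 = 0 ∧ b.1 + 1 = a.1)) ∨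
    (b.1 = a.1 ∧ (b.2 = a.2 + 1 ∨ a.2 = b.2 + 1)))

/-- The edge formed by a dimer. -/
def dimerEdge (n : ℕ) (d : ℕ × ℕ) :
    Sym2 (Fin (4 * refinedSide n + 1) × Fin (2 * refinedSide n + 1)) :=
  s(gridVertex n (entry d), gridVertex n (leave d))

/-- The block that contains a dimer. -/
def dimerBlock (d : ℕ × ℕ) : ℕ × ℕ := (d.1 / 2 + 1, (d.2 - 1) / 2 + 1)

theorem ValidDimer.coords_entry {d : ℕ × ℕ} (hd : ValidDimer n d) :
    coords (gridVertex n (entry d)) = entry d :=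
  coords_gridVertex (by have := hd.1; simp only [entry]; omega) hd.2.2

theorem ValidDimer.coords_leave {d : ℕ × ℕ} (hd : ValidDimer n d) :
    coords (gridVertex n (leave d)) = leave d :=
  coords_gridVertex (by have := hd.1; simp only [leave]; omega) hd.2.2

/-- Entries lie on the left in odd rows and on the right in even rows. Hence a hole at the exit of
`a` sees the entry of the next dimer ahead in its row, and also the entries directly above and
below. -/
theorem DimerArc.adj {a b : ℕ × ℕ} (ha : ValidDimer n a) (h : DimerArc n a b) :
    (reductionGraph n).Adj (gridVertex n (leave a)) (gridVertex n (entry b)) := by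
  obtain ⟨hb, h⟩ := h
  rw [gridGraph_adj, ha.coords_leave, hb.coords_entry]
  simp only [entry, leave]
  omega

theorem ValidDimer.dimerEdge_mem {d : ℕ × ℕ} (hd : ValidDimer n d) :
    dimerEdge n d ∈ initialMatching K low := by
  obtain ⟨h₁, h₂, h₃⟩ := id hd
  rw [dimerEdge, mem_initialMatching, hd.coords_entry, hd.coords_leave]
  by_cases hr : d.2 % 2 = 1
  · exact Or.inl (Or.inl ⟨rfl, by simp only [entry, leave]; omega,
      Or.inr ⟨h₂, h₃, by simp only [entry]; omega, by simp only [entry]; omega⟩⟩)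
  · exact Or.inr (Or.inl ⟨rfl, by simp only [entry, leave]; omega,
      Or.inr ⟨h₂, h₃, by simp only [leave]; omega, by simp only [leave]; omega⟩⟩)

theorem map_dimerEdge {d : ℕ × ℕ} (hd : ValidDimer n d) :
    (dimerEdge n d).map coords = s(entry d, leave d) := by
  rw [dimerEdge, Sym2.map_mk, hd.coords_entry, hd.coords_leave]

theorem dimerEdge_injective {d d' : ℕ × ℕ} (hd : ValidDimer n d) (hd' : ValidDimer n d')
    (h : dimerEdge n d = dimerEdge n d') : d = d' := by
  have h₁ := congrArg (Sym2.map coords) h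
  rw [map_dimerEdge hd, map_dimerEdge hd'] at h₁
  simp only [Sym2.eq_iff, entry, leave, Prod.mk.injEq] at h₁
  apply Prod.ext <;> omega

/-- The dimers outside `E`. -/
def untouched (n : ℕ) (E : Finset (ℕ × ℕ)) :
    Set (Sym2 (Fin (4 * refinedSide n + 1) × Fin (2 * refinedSide n + 1))) :=
  {e | ∃ d, ValidDimer n d ∧ d ∉ E ∧ e = dimerEdge n d}

/-- A closed tour of the isolated vertex that touches exactly the dimers of `E` and switches exactly
the blocks of `Q`. -/
structure DimerTour (K : Finset (Fin n × Fin n)) (low : Fin n × Fin n) (E Q : Finset (ℕ × ℕ))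
    (m : ℕ) (P : Set (Fin (4 * refinedSide n + 1) × Fin (2 * refinedSide n + 1))) : Prop where
  tour : FlipTour (reductionGraph n) (untouched n E) (initialMatching K low)
    (switchedMatching K low Q) m P
  valid : ∀ d ∈ E, ValidDimer n d
  leave_mem : ∀ d ∈ E, gridVertex n (leave d) ∈ P
  subset_terminals : (Q : Set (ℕ × ℕ)) ⊆ refinedTerminals K low
  mem_of_block : ∀ d, ValidDimer n d → dimerBlock d ∈ Q → d ∈ E
  block_mem : ∀ d ∈ E, dimerBlock d ∈ refinedTerminals K low → dimerBlock d ∈ Q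
  length_eq : m + 3 * Q.card = 2 * E.card

/-- Outside the terminal blocks, a new dimer costs an excursion of two flips. -/
theorem DimerTour.extend_dimer {E Q : Finset (ℕ × ℕ)} {m : ℕ}
    {P : Set (Fin (4 * refinedSide n + 1) × Fin (2 * refinedSide n + 1))}
    (h : DimerTour K low E Q m P) {v} (hv : v ∈ P) {b : ℕ × ℕ} (hb : ValidDimer n b)
    (hbE : b ∉ E) (hbT : dimerBlock b ∉ refinedTerminals K low)
    (hadj : (reductionGraph n).Adj v (gridVertex n (entry b))) :
    ∃ P', DimerTour K low (insert b E) Q (m + 2) P' := by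
  obtain ⟨P', hP', hT⟩ := h.tour.insert_edge hv hadj ⟨b, hb, hbE, rfl⟩
  refine ⟨P', hT.mono ?_, ?_, ?_, h.subset_terminals, ?_, ?_, ?_⟩
  · rintro _ ⟨d, hd, hdE, rfl⟩
    rw [Finset.mem_insert, not_or] at hdE
    exact ⟨⟨d, hd, hdE.2, rfl⟩, fun h => hdE.1 (dimerEdge_injective hd hb h)⟩
  · intro d hd
    rcases Finset.mem_insert.1 hd with rfl | hd
    · exact hb
    · exact h.valid d hd
  · intro d hd
    rcases Finset.mem_insert.1 hd with rfl | hd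
    · exact hP' (Or.inl rfl)
    · exact hP' (Or.inr (h.leave_mem d hd))
  · exact fun d hd hdQ => Finset.mem_insert_of_mem (h.mem_of_block d hd hdQ)
  · intro d hd hdT
    rcases Finset.mem_insert.1 hd with rfl | hd
    · exact absurd hdT hbT
    · exact h.block_mem d hd hdT
  · rw [Finset.card_insert_of_notMem hbE]
    have := h.length_eq
    omega

/-- The edge along which the isolated vertex moves from `a` to `b`. -/
def linkEdge (n : ℕ) (a b : ℕ × ℕ) :
    Sym2 (Fin (4 * refinedSide n + 1) × Fin (2 * refinedSide n + 1)) :=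
  s(gridVertex n (leave a), gridVertex n (entry b))

/-- A terminal block brings four dimers but only five flips, since the hole goes round the cycle;
hence the saving of 3 per block in `length_eq`. -/
theorem DimerTour.extend_cycle {E Q : Finset (ℕ × ℕ)} {m : ℕ}
    {P : Set (Fin (4 * refinedSide n + 1) × Fin (2 * refinedSide n + 1))}
    (h : DimerTour K low E Q m P) {v} (hv : v ∈ P) {t : ℕ × ℕ} (ht : t ∈ refinedTerminals K low)
    (htQ : t ∉ Q) {b₀ b₁ b₂ b₃ : ℕ × ℕ}
    (hb : ∀ d, (ValidDimer n d ∧ dimerBlock d = t) ↔ d ∈ ({b₀, b₁, b₂, b₃} : Finset (ℕ × ℕ)))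
    (hnd : [b₀, b₁, b₂, b₃].Nodup) (h₀ : DimerArc n b₀ b₁) (h₁ : DimerArc n b₁ b₂)
    (h₂ : DimerArc n b₂ b₃) (h₃ : DimerArc n b₃ b₀)
    (hH : hEdges n {t} = {dimerEdge n b₀, dimerEdge n b₁, dimerEdge n b₂, dimerEdge n b₃})
    (hS : sEdges n {t} = {linkEdge n b₀ b₁, linkEdge n b₁ b₂, linkEdge n b₂ b₃, linkEdge n b₃ b₀})
    (hadj : (reductionGraph n).Adj v (gridVertex n (entry b₀))) :
    ∃ P', DimerTour K low ({b₀, b₁, b₂, b₃} ∪ E) (insert t Q) (m + 5) P' := by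
  -- Terminal blocks are toured entirely or not at all, so an unswitched block is untouched.
  have hbE : ∀ d ∈ ({b₀, b₁, b₂, b₃} : Finset (ℕ × ℕ)), d ∉ E := by
    intro d hd hdE
    obtain ⟨-, hdt⟩ := (hb d).2 hd
    exact htQ (hdt ▸ h.block_mem d hdE (hdt ▸ ht))
  have v₀ := ((hb b₀).2 (by simp)).1
  have v₁ := ((hb b₁).2 (by simp)).1
  have v₂ := ((hb b₂).2 (by simp)).1
  have v₃ := ((hb b₃).2 (by simp)).1
  have hHC : hEdges n {t} ⊆ untouched n E := by
    rw [hH]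
    rintro e (rfl | rfl | rfl | rfl)
    · exact ⟨b₀, v₀, hbE _ (by simp), rfl⟩
    · exact ⟨b₁, v₁, hbE _ (by simp), rfl⟩
    · exact ⟨b₂, v₂, hbE _ (by simp), rfl⟩
    · exact ⟨b₃, v₃, hbE _ (by simp), rfl⟩
  have hnd' : [gridVertex n (entry b₀), gridVertex n (leave b₀), gridVertex n (entry b₁),
      gridVertex n (leave b₁), gridVertex n (entry b₂), gridVertex n (leave b₂),
      gridVertex n (entry b₃), gridVertex n (leave b₃)].Nodup := by
    apply List.Nodup.of_map coords
    simp only [List.map_cons, List.map_nil, v₀.coords_entry, v₁.coords_entry, v₂.coords_entry,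
      v₃.coords_entry, v₀.coords_leave, v₁.coords_leave, v₂.coords_leave, v₃.coords_leave]
    have e₁ : ∀ d : ℕ × ℕ, entry d ≠ leave d := by
      intro d h
      have := congrArg Prod.fst h
      simp only [entry, leave] at this
      omega
    have e₂ : ∀ {d d' : ℕ × ℕ}, d ≠ d' → entry d ≠ entry d' ∧ leave d ≠ leave d' ∧
        entry d ≠ leave d' ∧ leave d ≠ entry d' := by
      intro d d' hd
      have hd' : ¬ (d.1 = d'.1 ∧ d.2 = d'.2) := fun h => hd (Prod.ext h.1 h.2)
      simp only [entry, leave, ne_eq, Prod.mk.injEq]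
      omega
    simp only [List.nodup_cons, List.mem_cons, List.not_mem_nil, or_false, not_or,
      List.nodup_nil, and_true, not_false_eq_true] at hnd ⊢
    have k₁ := e₂ hnd.1.1
    have k₂ := e₂ hnd.1.2.1
    have k₃ := e₂ hnd.1.2.2
    have k₄ := e₂ hnd.2.1.1
    have k₅ := e₂ hnd.2.1.2
    have k₆ := e₂ hnd.2.2
    refine ⟨⟨e₁ _, ?_⟩, ?_, ⟨e₁ _, ?_⟩, ?_, ⟨e₁ _, ?_⟩, ?_, e₁ _⟩ <;> tauto
  obtain ⟨P', hP', hT⟩ := h.tour.insert_cycle hv hnd' hadj (h₀.adj v₀) (h₁.adj v₁) (h₂.adj v₂)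
    (h₃.adj v₃) hH hS hHC
  rw [← switchedMatching_insert (h.subset_terminals.trans refinedTerminals_subset)
    (refinedTerminals_subset ht), ← Finset.coe_insert] at hT
  refine ⟨P', hT.mono ?_, ?_, ?_, ?_, ?_, ?_, ?_⟩
  · rintro _ ⟨d, hd, hdE, rfl⟩
    rw [Finset.mem_union, not_or] at hdE
    refine ⟨⟨d, hd, hdE.2, rfl⟩, fun hmem => hdE.1 ?_⟩
    rw [hH] at hmem
    rcases hmem with hmem | hmem | hmem | hmem
    · rw [dimerEdge_injective hd v₀ hmem]; simp
    · rw [dimerEdge_injective hd v₁ hmem]; simp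
    · rw [dimerEdge_injective hd v₂ hmem]; simp
    · rw [dimerEdge_injective hd v₃ hmem]; simp
  · intro d hd
    rcases Finset.mem_union.1 hd with hd | hd
    · exact ((hb d).2 hd).1
    · exact h.valid d hd
  · intro d hd
    rcases Finset.mem_union.1 hd with hd | hd
    · refine hP' (Or.inr ?_)
      simp only [Finset.mem_insert, Finset.mem_singleton] at hd
      rcases hd with rfl | rfl | rfl | rfl <;> simp
    · exact hP' (Or.inl (h.leave_mem d hd))
  · rw [Finset.coe_insert]
    exact Set.insert_subset ht h.subset_terminals
  · intro d hd hdQ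
    rcases Finset.mem_insert.1 hdQ with hdt | hdQ
    · exact Finset.mem_union_left _ ((hb d).1 ⟨hd, hdt⟩)
    · exact Finset.mem_union_right _ (h.mem_of_block d hd hdQ)
  · intro d hd hdT
    rcases Finset.mem_union.1 hd with hd | hd
    · rw [((hb d).2 hd).2]
      simp
    · exact Finset.mem_insert_of_mem (h.block_mem d hd hdT)
  · rw [Finset.card_union_of_disjoint (Finset.disjoint_left.2 hbE),
      Finset.card_insert_of_notMem htQ]
    have hc : ({b₀, b₁, b₂, b₃} : Finset (ℕ × ℕ)).card = 4 := by
      have := List.toFinset_card_of_nodup hnd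
      simpa using this
    have := h.length_eq
    omega

theorem map_linkEdge {a b : ℕ × ℕ} (ha : ValidDimer n a) (hb : ValidDimer n b) :
    (linkEdge n a b).map coords = s(leave a, entry b) := by
  rw [linkEdge, Sym2.map_mk, ha.coords_leave, hb.coords_entry]

theorem inGrid_eq_of_forall {S : Set (Sym2 (ℕ × ℕ))} {e₀ e₁ e₂ e₃ : Sym2 (ℕ × ℕ)}
    {f₀ f₁ f₂ f₃ : Sym2 (Fin (4 * refinedSide n + 1) × Fin (2 * refinedSide n + 1))}
    (hS : S = {e₀, e₁, e₂, e₃}) (h₀ : f₀.map coords = e₀) (h₁ : f₁.map coords = e₁)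
    (h₂ : f₂.map coords = e₂) (h₃ : f₃.map coords = e₃) :
    inGrid (4 * refinedSide n + 1) (2 * refinedSide n + 1) S = {f₀, f₁, f₂, f₃} := by
  subst hS h₀ h₁ h₂ h₃
  have hinj := Sym2.map.injective
    (coords_injective (w := 4 * refinedSide n + 1) (h := 2 * refinedSide n + 1))
  ext e
  have : e ∈ inGrid (4 * refinedSide n + 1) (2 * refinedSide n + 1)
      {f₀.map coords, f₁.map coords, f₂.map coords, f₃.map coords} ↔
    e.map coords ∈ ({f₀.map coords, f₁.map coords, f₂.map coords, f₃.map coords} : Set _) :=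
    Iff.rfl
  rw [this]
  simp only [Set.mem_insert_iff, Set.mem_singleton_iff, hinj.eq_iff]

theorem sym2_eq_of_coords {a b c d a' b' c' d' : ℕ}
    (h : (a = a' ∧ b = b' ∧ c = c' ∧ d = d') ∨ (a = c' ∧ b = d' ∧ c = a' ∧ d = b')) :
    s((a, b), (c, d)) = s((a', b'), (c', d')) := by
  rcases h with ⟨rfl, rfl, rfl, rfl⟩ | ⟨rfl, rfl, rfl, rfl⟩
  · rfl
  · exact Sym2.eq_swap

theorem insert_rotate {α : Type*} (a b c d : α) : ({a, b, c, d} : Set α) = {b, c, d, a} := by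
  rw [Set.insert_comm a b, Set.insert_comm a c, Set.pair_comm a d]

theorem validDimer_block_iff {x y : ℕ} (hx : x < refinedSide n) (hy : y < refinedSide n)
    (d : ℕ × ℕ) : (ValidDimer n d ∧ dimerBlock d = (x + 1, y + 1)) ↔
      d = (2 * x, 2 * y + 1) ∨ d = (2 * x + 1, 2 * y + 1) ∨ d = (2 * x + 1, 2 * y + 2) ∨
      d = (2 * x, 2 * y + 2) := by
  obtain ⟨i, r⟩ := d
  simp only [ValidDimer, dimerBlock, Prod.mk.injEq]
  omega

theorem hEdges_singleton {x y : ℕ} (hx : x < refinedSide n) (hy : y < refinedSide n) :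
    hEdges n {(x + 1, y + 1)} = {dimerEdge n (2 * x, 2 * y + 1),
      dimerEdge n (2 * x + 1, 2 * y + 1), dimerEdge n (2 * x + 1, 2 * y + 2),
      dimerEdge n (2 * x, 2 * y + 2)} := by
  have hmem := validDimer_block_iff hx hy
  rw [hEdges, Set.biUnion_singleton]
  refine inGrid_eq_of_forall 
    (congrArg (insert _) (congrArg (insert _) (Set.pair_comm _ _))) ?_ ?_ ?_ ?_
  all_goals
    rw [map_dimerEdge ((hmem _).2 (by simp)).1]
    dsimp only [entry, leave, blockCorner]
    apply sym2_eq_of_coords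
    omega

theorem sEdges_singleton {x y : ℕ} (hx : x < refinedSide n) (hy : y < refinedSide n) :
    sEdges n {(x + 1, y + 1)} = {linkEdge n (2 * x, 2 * y + 1) (2 * x + 1, 2 * y + 1),
      linkEdge n (2 * x + 1, 2 * y + 1) (2 * x + 1, 2 * y + 2),
      linkEdge n (2 * x + 1, 2 * y + 2) (2 * x, 2 * y + 2),
      linkEdge n (2 * x, 2 * y + 2) (2 * x, 2 * y + 1)} := by
  have hmem := validDimer_block_iff hx hy
  rw [sEdges, Set.biUnion_singleton, ← insert_rotate]
  refine inGrid_eq_of_forall 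
    (congrArg (insert _) (congrArg (insert _) (Set.pair_comm _ _))) ?_ ?_ ?_ ?_
  all_goals
    rw [map_linkEdge ((hmem _).2 (by simp)).1 ((hmem _).2 (by simp)).1]
    dsimp only [entry, leave, blockCorner]
    apply sym2_eq_of_coords
    omega

theorem dimerArc_block {x y : ℕ} (hx : x < refinedSide n) (hy : y < refinedSide n) :
    DimerArc n (2 * x, 2 * y + 1) (2 * x + 1, 2 * y + 1) ∧
    DimerArc n (2 * x + 1, 2 * y + 1) (2 * x + 1, 2 * y + 2) ∧
    DimerArc n (2 * x + 1, 2 * y + 2) (2 * x, 2 * y + 2) ∧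
    DimerArc n (2 * x, 2 * y + 2) (2 * x, 2 * y + 1) := by
  have hmem := validDimer_block_iff hx hy
  refine ⟨⟨((hmem _).2 (by simp)).1, Or.inl ⟨rfl, Or.inl ⟨?_, rfl⟩⟩⟩,
    ⟨((hmem _).2 (by simp)).1, Or.inr ⟨rfl, Or.inl rfl⟩⟩,
    ⟨((hmem _).2 (by simp)).1, Or.inl ⟨rfl, Or.inr ⟨?_, rfl⟩⟩⟩,
    ⟨((hmem _).2 (by simp)).1, Or.inr ⟨rfl, Or.inr rfl⟩⟩⟩
  all_goals
    simp only
    omega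

theorem DimerTour.extend_block {E Q : Finset (ℕ × ℕ)} {m : ℕ}
    {P : Set (Fin (4 * refinedSide n + 1) × Fin (2 * refinedSide n + 1))}
    (h : DimerTour K low E Q m P) {v} (hv : v ∈ P) {b : ℕ × ℕ} (hb : ValidDimer n b)
    (hbE : b ∉ E) (hbT : dimerBlock b ∈ refinedTerminals K low)
    (hadj : (reductionGraph n).Adj v (gridVertex n (entry b))) :
    ∃ B P', DimerTour K low (B ∪ E) (insert (dimerBlock b) Q) (m + 5) P' ∧
      ∀ d, d ∈ B ↔ ValidDimer n d ∧ dimerBlock d = dimerBlock b := by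
  have htQ : dimerBlock b ∉ Q := fun hmem => hbE (h.mem_of_block b hb hmem)
  obtain ⟨⟨x, y⟩, ht⟩ : ∃ z : ℕ × ℕ, dimerBlock b = (z.1 + 1, z.2 + 1) :=
    ⟨(b.1 / 2, (b.2 - 1) / 2), rfl⟩
  dsimp only at ht
  have hgrid := refinedTerminals_subset hbT
  rw [ht] at htQ hbT hgrid ⊢
  have hx : x < refinedSide n := hgrid.1.2
  have hy : y < refinedSide n := hgrid.2.2
  have hmem := validDimer_block_iff hx hy
  have hH := hEdges_singleton hx hy
  have hS := sEdges_singleton hx hy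
  obtain ⟨a₀, a₁, a₂, a₃⟩ := dimerArc_block hx hy
  -- The block may be entered at any of its four dimers; the cases below are the cyclic rotations of
  -- one counterclockwise order.
  have aux : ∀ b₁ b₂ b₃ : ℕ × ℕ,
      (∀ d, (ValidDimer n d ∧ dimerBlock d = (x + 1, y + 1)) ↔
        d ∈ ({b, b₁, b₂, b₃} : Finset (ℕ × ℕ))) →
      [b, b₁, b₂, b₃].Nodup → DimerArc n b b₁ → DimerArc n b₁ b₂ → DimerArc n b₂ b₃ →
      DimerArc n b₃ b →
      hEdges n {(x + 1, y + 1)} =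
        {dimerEdge n b, dimerEdge n b₁, dimerEdge n b₂, dimerEdge n b₃} →
      sEdges n {(x + 1, y + 1)} =
        {linkEdge n b b₁, linkEdge n b₁ b₂, linkEdge n b₂ b₃, linkEdge n b₃ b} →
      ∃ B P', DimerTour K low (B ∪ E) (insert (x + 1, y + 1) Q) (m + 5) P' ∧
        ∀ d, d ∈ B ↔ ValidDimer n d ∧ dimerBlock d = (x + 1, y + 1) := by
    intro b₁ b₂ b₃ hb hnd h₀ h₁ h₂ h₃ hH hS
    obtain ⟨P', hP'⟩ := h.extend_cycle hv hbT htQ hb hnd h₀ h₁ h₂ h₃ hH hS hadj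
    exact ⟨_, P', hP', fun d => (hb d).symm⟩
  rcases (hmem b).1 ⟨hb, ht⟩ with rfl | rfl | rfl | rfl
  · refine aux _ _ _ (fun d => ?_) (by simp) a₀ a₁ a₂ a₃ hH hS
    rw [hmem]; simp only [Finset.mem_insert, Finset.mem_singleton]
  · rw [insert_rotate] at hH hS
    refine aux _ _ _ (fun d => ?_) (by simp) a₁ a₂ a₃ a₀ hH hS
    rw [hmem]
    simp only [Finset.mem_insert, Finset.mem_singleton]
    constructor <;> (rintro (h | h | h | h) <;> simp [h])
  · rw [insert_rotate, insert_rotate] at hH hS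
    refine aux _ _ _ (fun d => ?_) (by simp) a₂ a₃ a₀ a₁ hH hS
    rw [hmem]
    simp only [Finset.mem_insert, Finset.mem_singleton]
    constructor <;> (rintro (h | h | h | h) <;> simp [h])
  · rw [← insert_rotate] at hH hS
    refine aux _ _ _ (fun d => ?_) (by simp) a₃ a₀ a₁ a₂ hH hS
    rw [hmem]
    simp only [Finset.mem_insert, Finset.mem_singleton]
    constructor <;> (rintro (h | h | h | h) <;> simp [h])

theorem DimerTour.extend {E Q : Finset (ℕ × ℕ)} {m : ℕ}
    {P : Set (Fin (4 * refinedSide n + 1) × Fin (2 * refinedSide n + 1))}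
    (h : DimerTour K low E Q m P) {v} (hv : v ∈ P) {b : ℕ × ℕ} (hb : ValidDimer n b)
    (hbE : b ∉ E) (hadj : (reductionGraph n).Adj v (gridVertex n (entry b))) :
    ∃ E' Q' m' P', DimerTour K low E' Q' m' P' ∧ insert b E ⊆ E' ∧
      ∀ d ∈ E', d ∈ insert b E ∨ ValidDimer n d ∧ dimerBlock d ∈ refinedTerminals K low := by
  by_cases hbT : dimerBlock b ∈ refinedTerminals K low
  · obtain ⟨B, P', hP', hB⟩ := h.extend_block hv hb hbE hbT hadj
    refine ⟨_, _, _, P', hP', ?_, ?_⟩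
    · intro d hd
      rcases Finset.mem_insert.1 hd with rfl | hd
      · exact Finset.mem_union_left _ ((hB d).2 ⟨hb, rfl⟩)
      · exact Finset.mem_union_right _ hd
    · intro d hd
      rcases Finset.mem_union.1 hd with hd | hd
      · obtain ⟨hd₁, hd₂⟩ := (hB d).1 hd
        exact Or.inr ⟨hd₁, hd₂ ▸ hbT⟩
      · exact Or.inl (Finset.mem_insert_of_mem hd)
  · obtain ⟨P', hP'⟩ := h.extend_dimer hv hb hbE hbT hadj
    exact ⟨_, _, _, P', hP', subset_rfl, fun d hd => Or.inl hd⟩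

/-- A set of dimers spread from a dimer next to the isolated vertex can be toured. -/
theorem exists_dimerTour {r : ℕ × ℕ} (hr : ValidDimer n r)
    (hadj : (reductionGraph n).Adj (gridVertex n (holeColumn low, 0)) (gridVertex n (entry r)))
    {D : Finset (ℕ × ℕ)} (hD : Spread (DimerArc n) r D) :
    ∃ E Q m P, DimerTour K low E Q m P ∧ D ⊆ E ∧
      ∀ d ∈ E, d ∈ D ∨ ValidDimer n d ∧ dimerBlock d ∈ refinedTerminals K low := by
  induction hD with
  | base =>
    have h₀ : DimerTour K low ∅ ∅ 0 {gridVertex n (holeColumn low, 0)} := by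
      refine ⟨?_, by simp, by simp, by simp, by simp, by simp, by simp⟩
      rw [Finset.coe_empty, switchedMatching_empty]
      refine .nil isOddMatching_initialMatching isolated_initialMatching ?_
      rintro _ ⟨d, hd, -, rfl⟩
      exact hd.dimerEdge_mem
    obtain ⟨E, Q, m, P, h, h₁, h₂⟩ := h₀.extend rfl hr (by simp) hadj
    exact ⟨E, Q, m, P, h, h₁, h₂⟩
  | @step D a b _ ha hab ih =>
    obtain ⟨E, Q, m, P, h, h₁, h₂⟩ := ih
    by_cases hbE : b ∈ E
    · refine ⟨E, Q, m, P, h, Finset.insert_subset hbE h₁, fun d hd => ?_⟩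
      exact (h₂ d hd).imp_left Finset.mem_insert_of_mem
    · obtain ⟨E', Q', m', P', h', h₁', h₂'⟩ := h.extend (h.leave_mem a (h₁ ha)) hab.1 hbE
        (hab.adj (h.valid a (h₁ ha)))
      refine ⟨E', Q', m', P', h', (Finset.insert_subset_insert b h₁).trans h₁', fun d hd => ?_⟩
      rcases h₂' d hd with hd | hd
      · rcases Finset.mem_insert.1 hd with rfl | hd
        · exact Or.inl (Finset.mem_insert_self _ _)
        · exact (h₂ d hd).imp_left Finset.mem_insert_of_mem
      · exact Or.inr hd

theorem refinePoint_injOn (hmin : ∀ v ∈ K, low.2 ≤ v.2) :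
    Set.InjOn (refinePoint low) (K : Set (Fin n × Fin n)) := by
  intro u hu v hv h
  have hn : 0 < 8 * n := by have := u.1.2; omega
  simp only [refinePoint, Prod.mk.injEq, Nat.add_right_cancel_iff, Nat.mul_right_inj hn.ne'] at h
  have h₁ : (low.2 : ℕ) ≤ u.2 := hmin u hu
  have h₂ : (low.2 : ℕ) ≤ v.2 := hmin v hv
  exact Prod.ext (Fin.ext h.1) (Fin.ext (by omega))

/-- The flip sequence obtained from a spread set of dimers that contains the blocks of all
terminals. -/
theorem hasFlipSequence_of_spread (hmin : ∀ v ∈ K, low.2 ≤ v.2) {r : ℕ × ℕ} (hr : ValidDimer n r)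
    (hadj : (reductionGraph n).Adj (gridVertex n (holeColumn low, 0)) (gridVertex n (entry r)))
    {D : Finset (ℕ × ℕ)} (hD : Spread (DimerArc n) r D)
    (hK : ∀ d, ValidDimer n d → dimerBlock d ∈ refinedTerminals K low → d ∈ D) :
    ∃ m, m + 3 * K.card = 2 * D.card ∧
      HasFlipSequence (reductionGraph n) (initialMatching K low) (targetMatching K low) m := by
  classical
  obtain ⟨E, Q, m, P, h, h₁, h₂⟩ := exists_dimerTour hr hadj hD (K := K)
  -- Touring completes terminal blocks early, so `E` could exceed an intermediate spread set; the
  -- final `D` contains these blocks anyway.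
  have hE : E = D := by
    refine Finset.Subset.antisymm (fun d hd => ?_) h₁
    rcases h₂ d hd with h | h
    · exact h
    · exact hK d h.1 h.2
  have hQ : (Q : Set (ℕ × ℕ)) = refinedTerminals K low := by
    refine h.subset_terminals.antisymm fun t ht => ?_
    have hg := refinedTerminals_subset ht
    obtain ⟨a, b⟩ := t
    simp only [refinedGrid, Set.mem_ofPred_eq, Set.mem_Icc] at hg
    have hb : dimerBlock (2 * (a - 1), 2 * (b - 1) + 1) = (a, b) := by
      apply Prod.ext <;> (simp only [dimerBlock]; omega)
    have := h.block_mem (2 * (a - 1), 2 * (b - 1) + 1) (h₁ (hK _ ?_ (hb ▸ ht))) (hb ▸ ht)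
    · rwa [hb] at this
    · simp only [ValidDimer]
      omega
  have hcard : Q.card = K.card := by
    have : Q = K.image (refinePoint low) := by
      rw [← Finset.coe_inj, hQ]
      ext p
      simp only [refinedTerminals, Set.mem_ofPred_eq, Finset.coe_image, Set.mem_image,
        Finset.mem_coe, eq_comm]
    rw [this, Finset.card_image_of_injOn (refinePoint_injOn hmin)]
  refine ⟨m, ?_, ?_⟩
  · rw [← hcard, ← hE]
    exact h.length_eq
  · rw [← switchedMatching_refinedTerminals, ← hQ]
    exact h.tour.hasFlipSequence

end Dimers

/-! ### Normal form of grown trees -/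

/-- The Manhattan distance of two grid points. -/
def gridDist (p q : ℕ × ℕ) : ℕ := (p.1 - q.1) + (q.1 - p.1) + ((p.2 - q.2) + (q.2 - p.2))

/-- The `n × n` grid. -/
def InBox (n : ℕ) (p : ℕ × ℕ) : Prop := p.1 < n ∧ p.2 < n

theorem gridDist_triangle (p q r : ℕ × ℕ) : gridDist p r ≤ gridDist p q + gridDist q r := by
  simp only [gridDist]
  omega

theorem gridDist_self (p : ℕ × ℕ) : gridDist p p = 0 := by
  simp [gridDist]

/-- Rooted binary trees of total length `l` in the grid with a given multiset of leaves. -/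
inductive NormalTree (n : ℕ) : ℕ × ℕ → Multiset (ℕ × ℕ) → ℕ → Prop
  | leaf (p : ℕ × ℕ) : InBox n p → NormalTree n p {p} 0
  | join {p q₁ q₂ : ℕ × ℕ} {m₁ m₂ : Multiset (ℕ × ℕ)} {l₁ l₂ : ℕ} : InBox n p →
      NormalTree n q₁ m₁ l₁ → NormalTree n q₂ m₂ l₂ →
      NormalTree n p (m₁ + m₂) (l₁ + l₂ + gridDist p q₁ + gridDist p q₂)

namespace NormalTree

variable {n l : ℕ} {p a b : ℕ × ℕ} {m : Multiset (ℕ × ℕ)}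

theorem inBox (h : NormalTree n p m l) : InBox n p := by
  cases h <;> assumption

/-- Moving a leaf. -/
theorem move_leaf (h : NormalTree n p m l) (ha : a ∈ m) (hb : InBox n b) :
    ∃ p' l', NormalTree n p' (b ::ₘ m.erase a) l' ∧ l' + gridDist p p' ≤ l + gridDist a b := by
  induction h with
  | leaf p =>
    obtain rfl := Multiset.mem_singleton.1 ha
    exact ⟨b, 0, by simpa using NormalTree.leaf b hb, le_rfl⟩
  | @join p q₁ q₂ m₁ m₂ l₁ l₂ hp h₁ h₂ ih₁ ih₂ =>
    by_cases ha₁ : a ∈ m₁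
    · obtain ⟨q, l', h', hl⟩ := ih₁ ha₁
      rw [Multiset.erase_add_left_pos _ ha₁, ← Multiset.cons_add]
      refine ⟨p, _, .join hp h' h₂, ?_⟩
      · have := gridDist_triangle p q₁ q
        rw [gridDist_self]
        omega
    · have ha₂ : a ∈ m₂ := (Multiset.mem_add.1 ha).resolve_left ha₁
      obtain ⟨q, l', h', hl⟩ := ih₂ ha₂
      rw [Multiset.erase_add_right_pos _ ha₂, ← Multiset.add_cons]
      refine ⟨p, _, .join hp h₁ h', ?_⟩
      · have := gridDist_triangle p q₂ q
        rw [gridDist_self]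
        omega

/-- Adding a leaf next to a given one. -/
theorem add_leaf (h : NormalTree n p m l) (ha : a ∈ m) (hb : InBox n b) :
    ∃ l', NormalTree n p (b ::ₘ m) l' ∧ l' ≤ l + gridDist a b := by
  induction h with
  | leaf p hp =>
    obtain rfl := Multiset.mem_singleton.1 ha
    refine ⟨_, NormalTree.join hp (.leaf b hb) (.leaf a hp), ?_⟩
    rw [gridDist_self]
    omega
  | @join p q₁ q₂ m₁ m₂ l₁ l₂ hp h₁ h₂ ih₁ ih₂ =>
    rcases Multiset.mem_add.1 ha with ha | ha
    · obtain ⟨l', h', hl⟩ := ih₁ ha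
      refine ⟨_, Multiset.cons_add b m₁ m₂ ▸ NormalTree.join hp h' h₂, ?_⟩
      omega
    · obtain ⟨l', h', hl⟩ := ih₂ ha
      refine ⟨_, Multiset.add_cons b m₁ m₂ ▸ NormalTree.join hp h₁ h', ?_⟩
      omega

end NormalTree

/-- Induction on the last point `q` joined, with `K` varying. If `q` is not required, it is dropped.
Otherwise its neighbour `p` takes its place, and the resulting tree is extended from `p` to `q` at
cost `gridDist p q`. -/
theorem Grown.exists_normalTree {n : ℕ} {r : ℕ × ℕ} {W : Set (ℕ × ℕ)} {L : ℕ}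
    (h : Grown gridDist r W L) (hW : ∀ p ∈ W, InBox n p) (K : Finset (ℕ × ℕ))
    (hK : ∀ p ∈ K, p ∈ W) (hne : K.Nonempty) :
    ∃ q l, NormalTree n q K.val l ∧ l + gridDist r q ≤ L := by
  induction h generalizing K with
  | base =>
    have : K = {r} := Finset.eq_singleton_iff_nonempty_unique_mem.2 ⟨hne, hK⟩
    subst this
    exact ⟨r, 0, .leaf r (hW r rfl), by simp [gridDist_self]⟩
  | @step W l p q hG hp ih =>
    have ih := ih fun x hx => hW x (Or.inr hx)
    have hq := hW q (Or.inl rfl)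
    by_cases hqK : q ∈ K
    · have hsub : ∀ x ∈ insert p (K.erase q), x ∈ W := by
        intro x hx
        rcases Finset.mem_insert.1 hx with rfl | hx
        · exact hp
        · exact (hK x (Finset.mem_of_mem_erase hx)).resolve_left (Finset.ne_of_mem_erase hx)
      obtain ⟨q₀, l₀, hN, hl⟩ := ih (insert p (K.erase q)) hsub (by simp)
      have hKval : q ::ₘ (K.erase q).val = K.val := by
        rw [Finset.erase_val, Multiset.cons_erase hqK]
      -- If `p` is required too, its leaf must be kept and `q` becomes a sibling; otherwise the leaf
      -- at `p` is moved to `q`.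
      by_cases hpK : p ∈ K.erase q
      · rw [Finset.insert_eq_of_mem hpK] at hN
        obtain ⟨l', h', hl'⟩ := hN.add_leaf hpK hq
        rw [hKval] at h'
        exact ⟨q₀, l', h', by omega⟩
      · rw [Finset.insert_val_of_notMem hpK] at hN
        obtain ⟨q', l', h', hl'⟩ := hN.move_leaf (Multiset.mem_cons_self p _) hq
        rw [Multiset.erase_cons_head, hKval] at h'
        have := gridDist_triangle r q₀ q'
        exact ⟨q', l', h', by omega⟩
    · obtain ⟨q₀, l₀, hN, hl⟩ := ih K
        (fun x hx => (hK x hx).resolve_left (by rintro rfl; exact hqK hx)) hne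
      exact ⟨q₀, l₀, hN, by omega⟩

/-! ### Dimers along a tree -/

section DimerTree

variable {n : ℕ} {r : ℕ × ℕ} {D : Finset (ℕ × ℕ)}

theorem box_bound {x : ℕ} (hx : x < n) :
    16 * n * x + 16 ≤ 2 * refinedSide n := by
  have h1 : 16 * n * (x + 1) ≤ 16 * n * (n + 4 * n ^ 2) :=
    Nat.mul_le_mul_left _ (by have := Nat.zero_le (4 * n ^ 2); omega)
  have h2 : 2 * refinedSide n = 16 * n * (n + 4 * n ^ 2) := by rw [refinedSide]; ring
  rw [mul_add] at h1
  omega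

theorem scaled_mod (x : ℕ) : 16 * n * x % 2 = 0 := by
  rw [mul_assoc]
  omega

/-- A dimer in the right half of the block of the grid point `p` belongs to `D`. -/
def Reaches (n : ℕ) (D : Finset (ℕ × ℕ)) (p : ℕ × ℕ) : Prop :=
  ∃ ε, (ε = 1 ∨ ε = 2) ∧ (16 * n * p.1 + 1, 16 * n * p.2 + ε) ∈ D

theorem Reaches.mono {D' : Finset (ℕ × ℕ)} {p : ℕ × ℕ} (h : Reaches n D p) (hD : D ⊆ D') :
    Reaches n D' p := by
  obtain ⟨ε, h₁, h₂⟩ := h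
  exact ⟨ε, h₁, hD h₂⟩

/-- The summand 1 pays for changing to the other row of the block when the current one runs in the
wrong direction: `ε = 1` leads right, `ε = 2` leads left. -/
theorem Spread.horizontal (h : Spread (DimerArc n) r D) {p : ℕ × ℕ} {x : ℕ} (hp : InBox n p)
    (hx : x < n) (hD : Reaches n D p) :
    ∃ D', Spread (DimerArc n) r D' ∧ D ⊆ D' ∧
      D'.card ≤ D.card + 16 * n * ((p.1 - x) + (x - p.1)) + 1 ∧ Reaches n D' (x, p.2) := by
  have b₁ := box_bound hp.1
  have b₂ := box_bound hp.2
  have b₃ := box_bound hx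
  have hmod := scaled_mod (n := n) p.2
  rw [Nat.mul_add, Nat.mul_sub, Nat.mul_sub]
  obtain ⟨ε, hε, hmem⟩ := hD
  rcases lt_trichotomy p.1 x with hlt | heq | hlt
  · have hle : 16 * n * p.1 ≤ 16 * n * x := Nat.mul_le_mul_left _ hlt.le
    have hrow : ∃ D', Spread (DimerArc n) r D' ∧ D ⊆ D' ∧ D'.card ≤ D.card + 1 ∧
        (16 * n * p.1 + 1, 16 * n * p.2 + 1) ∈ D' := by
      rcases hε with rfl | rfl
      · exact ⟨D, h, subset_rfl, by omega, hmem⟩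
      · refine ⟨_, h.step (b := (16 * n * p.1 + 1, 16 * n * p.2 + 1)) hmem ?_,
          Finset.subset_insert _ _, Finset.card_insert_le _ _, Finset.mem_insert_self _ _⟩
        exact ⟨⟨by simp only; omega, by simp only; omega, by simp only; omega⟩,
          Or.inr ⟨rfl, Or.inr rfl⟩⟩
    obtain ⟨D₁, h₁, s₁, c₁, m₁⟩ := hrow
    obtain ⟨D₂, h₂, s₂, c₂, m₂⟩ := h₁.path (fun i => (16 * n * p.1 + 1 + i, 16 * n * p.2 + 1))
      (16 * n * x - 16 * n * p.1) m₁ (by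
        intro i hi
        exact ⟨⟨by simp only; omega, by simp only; omega, by simp only; omega⟩,
          Or.inl ⟨rfl, Or.inl ⟨by simp only; omega, rfl⟩⟩⟩)
    refine ⟨D₂, h₂, s₁.trans s₂, by omega, 1, Or.inl rfl, ?_⟩
    convert m₂ using 2
    simp only
    omega
  · subst heq
    exact ⟨D, h, subset_rfl, by omega, ε, hε, hmem⟩
  · have hle : 16 * n * x ≤ 16 * n * p.1 := Nat.mul_le_mul_left _ hlt.le
    have hrow : ∃ D', Spread (DimerArc n) r D' ∧ D ⊆ D' ∧ D'.card ≤ D.card + 1 ∧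
        (16 * n * p.1 + 1, 16 * n * p.2 + 2) ∈ D' := by
      rcases hε with rfl | rfl
      · refine ⟨_, h.step (b := (16 * n * p.1 + 1, 16 * n * p.2 + 2)) hmem ?_,
          Finset.subset_insert _ _, Finset.card_insert_le _ _, Finset.mem_insert_self _ _⟩
        exact ⟨⟨by simp only; omega, by simp only; omega, by simp only; omega⟩,
          Or.inr ⟨rfl, Or.inl rfl⟩⟩
      · exact ⟨D, h, subset_rfl, by omega, hmem⟩
    obtain ⟨D₁, h₁, s₁, c₁, m₁⟩ := hrow
    obtain ⟨D₂, h₂, s₂, c₂, m₂⟩ := h₁.path (fun i => (16 * n * p.1 + 1 - i, 16 * n * p.2 + 2))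
      (16 * n * p.1 - 16 * n * x) m₁ (by
        intro i hi
        exact ⟨⟨by simp only; omega, by simp only; omega, by simp only; omega⟩,
          Or.inl ⟨rfl, Or.inr ⟨by simp only; omega, by simp only; omega⟩⟩⟩)
    refine ⟨D₂, h₂, s₁.trans s₂, by omega, 2, Or.inr rfl, ?_⟩
    convert m₂ using 2
    simp only
    omega

/-- Vertical arcs exist in both directions, and the distance is a multiple of `16 * n`, so the row
`ε` within the block is kept at no additional cost. -/
theorem Spread.vertical (h : Spread (DimerArc n) r D) {p : ℕ × ℕ} {y : ℕ} (hp : InBox n p)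
    (hy : y < n) (hD : Reaches n D p) :
    ∃ D', Spread (DimerArc n) r D' ∧ D ⊆ D' ∧
      D'.card ≤ D.card + 16 * n * ((p.2 - y) + (y - p.2)) ∧ Reaches n D' (p.1, y) := by
  have b₁ := box_bound hp.1
  have b₂ := box_bound hp.2
  have b₃ := box_bound hy
  rw [Nat.mul_add, Nat.mul_sub, Nat.mul_sub]
  obtain ⟨ε, hε, hmem⟩ := hD
  rcases le_total p.2 y with hle | hle
  · have hle' : 16 * n * p.2 ≤ 16 * n * y := Nat.mul_le_mul_left _ hle
    obtain ⟨D₂, h₂, s₂, c₂, m₂⟩ := h.path (fun i => (16 * n * p.1 + 1, 16 * n * p.2 + ε + i))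
      (16 * n * y - 16 * n * p.2) hmem (by
        intro i hi
        exact ⟨⟨by simp only; omega, by simp only; omega, by simp only; omega⟩,
          Or.inr ⟨rfl, Or.inl rfl⟩⟩)
    refine ⟨D₂, h₂, s₂, by omega, ε, hε, ?_⟩
    convert m₂ using 2
    simp only
    omega
  · have hle' : 16 * n * y ≤ 16 * n * p.2 := Nat.mul_le_mul_left _ hle
    obtain ⟨D₂, h₂, s₂, c₂, m₂⟩ := h.path (fun i => (16 * n * p.1 + 1, 16 * n * p.2 + ε - i))
      (16 * n * p.2 - 16 * n * y) hmem (by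
        intro i hi
        exact ⟨⟨by simp only; omega, by simp only; omega, by simp only; omega⟩,
          Or.inr ⟨rfl, Or.inr (by simp only; omega)⟩⟩)
    refine ⟨D₂, h₂, s₂, by omega, ε, hε, ?_⟩
    convert m₂ using 2
    simp only
    omega

theorem Spread.arm (h : Spread (DimerArc n) r D) {p q : ℕ × ℕ} (hp : InBox n p) (hq : InBox n q)
    (hD : Reaches n D p) :
    ∃ D', Spread (DimerArc n) r D' ∧ D ⊆ D' ∧ D'.card ≤ D.card + 16 * n * gridDist p q + 1 ∧
      Reaches n D' q := by
  obtain ⟨D₁, h₁, s₁, c₁, m₁⟩ := h.horizontal hp hq.1 hD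
  obtain ⟨D₂, h₂, s₂, c₂, m₂⟩ := h₁.vertical (p := (q.1, p.2)) ⟨hq.1, hp.2⟩ hq.2 m₁
  refine ⟨D₂, h₂, s₁.trans s₂, ?_, m₂⟩
  rw [gridDist, Nat.mul_add]
  simp only at c₂
  omega

/-- From either dimer of the right half, three arcs of the 4-cycle of the block reach the others. -/
theorem Spread.block (h : Spread (DimerArc n) r D) {p : ℕ × ℕ} (hp : InBox n p)
    (hD : Reaches n D p) :
    ∃ D', Spread (DimerArc n) r D' ∧ D ⊆ D' ∧ D'.card ≤ D.card + 3 ∧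
      ∀ i ≤ 1, ∀ j ≤ 1, (16 * n * p.1 + i, 16 * n * p.2 + 1 + j) ∈ D' := by
  have b₁ := box_bound hp.1
  have b₂ := box_bound hp.2
  have hx : 8 * n * p.1 < refinedSide n := by
    have : 16 * n * p.1 = 2 * (8 * n * p.1) := by ring
    omega
  have hy : 8 * n * p.2 < refinedSide n := by
    have : 16 * n * p.2 = 2 * (8 * n * p.2) := by ring
    omega
  obtain ⟨a₀, a₁, a₂, a₃⟩ := dimerArc_block hx hy
  have ex : 2 * (8 * n * p.1) = 16 * n * p.1 := by ring
  have ey : 2 * (8 * n * p.2) = 16 * n * p.2 := by ring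
  rw [ex, ey] at a₀ a₁ a₂ a₃
  obtain ⟨ε, rfl | rfl, hmem⟩ := hD
  · refine ⟨_, ((h.step hmem a₁).step (Finset.mem_insert_self _ _) a₂).step
      (Finset.mem_insert_self _ _) a₃, ?_, ?_, ?_⟩
    · exact fun d hd => Finset.mem_insert_of_mem (Finset.mem_insert_of_mem
        (Finset.mem_insert_of_mem hd))
    · refine (Finset.card_insert_le _ _).trans (Nat.add_le_add_right
        ((Finset.card_insert_le _ _).trans (Nat.add_le_add_right (Finset.card_insert_le _ _) 1)) 1)
    · intro i hi j hj
      interval_cases i <;> interval_cases j <;> simp [hmem]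
  · refine ⟨_, ((h.step hmem a₂).step (Finset.mem_insert_self _ _) a₃).step
      (Finset.mem_insert_self _ _) a₀, ?_, ?_, ?_⟩
    · exact fun d hd => Finset.mem_insert_of_mem (Finset.mem_insert_of_mem
        (Finset.mem_insert_of_mem hd))
    · refine (Finset.card_insert_le _ _).trans (Nat.add_le_add_right
        ((Finset.card_insert_le _ _).trans (Nat.add_le_add_right (Finset.card_insert_le _ _) 1)) 1)
    · intro i hi j hj
      interval_cases i <;> interval_cases j <;> simp [hmem]

/-- With `m.card` leaves there are `2 * m.card - 2` edges, each with overhead 1, and each leaf block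
costs 3; together `5 * m.card - 2`. The second branch at a node starts again from `p`, which is
still reached because the spread set only grows. -/
theorem NormalTree.spread {p : ℕ × ℕ} {m : Multiset (ℕ × ℕ)} {l : ℕ} (hT : NormalTree n p m l) :
    ∀ D, Spread (DimerArc n) r D → Reaches n D p →
    ∃ D', Spread (DimerArc n) r D' ∧ D ⊆ D' ∧ D'.card + 2 ≤ D.card + 16 * n * l + 5 * m.card ∧
      ∀ t ∈ m, ∀ i ≤ 1, ∀ j ≤ 1, (16 * n * t.1 + i, 16 * n * t.2 + 1 + j) ∈ D' := by
  induction hT with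
  | leaf p hp =>
    intro D h hD
    obtain ⟨D', h', s', c', m'⟩ := h.block hp hD
    refine ⟨D', h', s', by simp only [Multiset.card_singleton]; omega, ?_⟩
    intro t ht
    obtain rfl := Multiset.mem_singleton.1 ht
    exact m'
  | @join p q₁ q₂ m₁ m₂ l₁ l₂ hp h₁ h₂ ih₁ ih₂ =>
    intro D h hD
    obtain ⟨D₁, k₁, s₁, c₁, r₁⟩ := h.arm hp h₁.inBox hD
    obtain ⟨D₂, k₂, s₂, c₂, r₂⟩ := ih₁ D₁ k₁ r₁
    obtain ⟨D₃, k₃, s₃, c₃, r₃⟩ := k₂.arm hp h₂.inBox ((hD.mono s₁).mono s₂)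
    obtain ⟨D₄, k₄, s₄, c₄, r₄⟩ := ih₂ D₃ k₃ r₃
    refine ⟨D₄, k₄, ((s₁.trans s₂).trans s₃).trans s₄, ?_, ?_⟩
    · rw [Multiset.card_add]
      simp only [Nat.mul_add] at *
      omega
    · intro t ht i hi j hj
      rcases Multiset.mem_add.1 ht with ht | ht
      · exact s₄ (s₃ (r₂ t ht i hi j hj))
      · exact r₄ t ht i hi j hj

/-- The terminals, translated vertically such that `low` gets height `0`. -/
def relativePoint (low v : Fin n × Fin n) : ℕ × ℕ := (v.1, (v.2 : ℕ) - (low.2 : ℕ))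

/-- A tree in the grid that contains the terminals yields a short flip sequence. -/
theorem Grown.exists_flipSequence {K : Finset (Fin n × Fin n)} {low : Fin n × Fin n}
    (hlow : low ∈ K) (hmin : ∀ v ∈ K, low.2 ≤ v.2) {W : Set (ℕ × ℕ)} {L : ℕ}
    (h : Grown gridDist (relativePoint low low) W L) (hW : ∀ p ∈ W, InBox n p)
    (hK : ∀ v ∈ K, relativePoint low v ∈ W) :
    ∃ m ≤ 4 * (8 * n) * L + 8 * K.card,
      HasFlipSequence (reductionGraph n) (initialMatching K low) (targetMatching K low) m := by
  have hinj : Set.InjOn (relativePoint low) (K : Set (Fin n × Fin n)) := by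
    intro u hu v hv huv
    have h₁ : (low.2 : ℕ) ≤ u.2 := hmin u hu
    have h₂ : (low.2 : ℕ) ≤ v.2 := hmin v hv
    simp only [relativePoint, Prod.mk.injEq] at huv
    exact Prod.ext (Fin.ext huv.1) (Fin.ext (by omega))
  obtain ⟨q, l, hT, hl⟩ := h.exists_normalTree hW (K.image (relativePoint low))
    (by
      intro x hx
      obtain ⟨v, hv, rfl⟩ := Finset.mem_image.1 hx
      exact hK v hv) (by simpa using ⟨low, hlow⟩)
  have hbox : InBox n (relativePoint low low) := hW _ h.root_mem
  have b₁ := box_bound hbox.1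
  have hr : ValidDimer n (16 * n * low.1 + 1, 1) :=
    ⟨by simp only [relativePoint] at *; omega, le_rfl, by simp only; omega⟩
  have hreach : Reaches n {(16 * n * (low.1 : ℕ) + 1, 1)} (relativePoint low low) :=
    ⟨1, Or.inl rfl, by simp [relativePoint]⟩
  obtain ⟨D₁, h₁, s₁, c₁, r₁⟩ :=
    (Spread.base (arc := DimerArc n)).arm hbox hT.inBox hreach
  obtain ⟨D, hD, s₂, c₂, r₂⟩ := hT.spread D₁ h₁ r₁
  have hadj : (reductionGraph n).Adj (gridVertex n (holeColumn low, 0))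
      (gridVertex n (entry (16 * n * low.1 + 1, 1))) := by
    rw [gridGraph_adj, hr.coords_entry,
      coords_gridVertex (p := (holeColumn low, 0)) (holeColumn_lt low).le (by simp)]
    have := holeColumn_eq low
    have e : 32 * n * (low.1 : ℕ) = 2 * (16 * n * (low.1 : ℕ)) := by ring
    exact Or.inr ⟨by simp only [entry]; omega, Or.inl rfl⟩
  obtain ⟨m, hm, hs⟩ := hasFlipSequence_of_spread hmin hr hadj hD (K := K) (by
    rintro ⟨i, j⟩ hd ⟨v, hv, hvd⟩
    simp only [dimerBlock, refinePoint, Prod.mk.injEq] at hvd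
    have e₁ : 16 * n * (v.1 : ℕ) = 2 * (8 * n * (v.1 : ℕ)) := by ring
    have e₂ : 16 * n * ((v.2 : ℕ) - (low.2 : ℕ)) = 2 * (8 * n * ((v.2 : ℕ) - (low.2 : ℕ))) := by
      ring
    have hj : 1 ≤ j := hd.2.1
    -- The corner of the block has an even first coordinate and an odd row, so these parities locate
    -- the dimer inside the block.
    have := r₂ (relativePoint low v) (Finset.mem_image_of_mem _ hv) (i % 2) (by omega)
      ((j - 1) % 2) (by omega)
    convert this using 2
    · simp only [relativePoint]; omega
    · simp only [relativePoint]; omega)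
  refine ⟨m, ?_, hs⟩
  have hcard : (K.image (relativePoint low)).val.card = K.card :=
    Finset.card_image_of_injOn hinj
  rw [hcard] at c₂
  rw [Finset.card_singleton] at c₁
  have e : 16 * n * (l + gridDist (relativePoint low low) q) ≤ 16 * n * L :=
    Nat.mul_le_mul_left _ hl
  have e' : 4 * (8 * n) * L = 2 * (16 * n * L) := by ring
  rw [Nat.mul_add] at e
  omega

end DimerTree

/-! ### Rounding trees to the grid -/

/-- The Manhattan distance in the plane. -/
def realDist (p q : ℝ × ℝ) : ℝ := |p.1 - q.1| + |p.2 - q.2|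

section Rounding

theorem monotone_floor_add (a : ℝ) : Monotone fun t : ℝ => ((⌊a + t⌋ : ℤ) : ℝ) := by
  intro s t hst
  simp only [Int.cast_le]
  exact Int.floor_mono (by linarith)

theorem intervalIntegrable_floor_add (a : ℝ) :
    IntervalIntegrable (fun t : ℝ => ((⌊a + t⌋ : ℤ) : ℝ)) MeasureTheory.volume 0 1 :=
  (monotone_floor_add a).intervalIntegrable

theorem integral_fract_add (a : ℝ) :
    ∫ t in (0 : ℝ)..1, Int.fract (a + t) = ∫ t in (0 : ℝ)..1, Int.fract t := by
  rw [intervalIntegral.integral_comp_add_left (fun t => Int.fract t)]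
  have h := (Int.fract_periodic ℝ).intervalIntegral_add_eq a 0
  simpa using h

/-- By periodicity the fractional part has the same average for every shift, so the averaged floor
is `a` plus a constant independent of `a`. -/
theorem integral_floor_add (a : ℝ) :
    ∫ t in (0 : ℝ)..1, ((⌊a + t⌋ : ℤ) : ℝ) =
      a + ((∫ t in (0 : ℝ)..1, t) - ∫ t in (0 : ℝ)..1, Int.fract t) := by
  have h₁ : IntervalIntegrable (fun t : ℝ => a + t) MeasureTheory.volume 0 1 :=
    (continuous_const.add continuous_id).intervalIntegrable _ _
  have h₂ : (fun t : ℝ => ((⌊a + t⌋ : ℤ) : ℝ)) = fun t => (a + t) - Int.fract (a + t) := by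
    ext t
    rw [Int.self_sub_fract]
  have h₃ : IntervalIntegrable (fun t : ℝ => Int.fract (a + t)) MeasureTheory.volume 0 1 := by
    have : (fun t : ℝ => Int.fract (a + t)) = fun t => (a + t) - ((⌊a + t⌋ : ℤ) : ℝ) := rfl
    rw [this]
    exact h₁.sub (intervalIntegrable_floor_add a)
  rw [h₂, intervalIntegral.integral_sub h₁ h₃, integral_fract_add,
    intervalIntegral.integral_add intervalIntegrable_const
      (f := fun _ => a) (g := fun t => t) (continuous_id.intervalIntegrable _ _)]
  simp
  ring

/-- On average over all shifts, rounding down preserves distances. -/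
theorem integral_abs_floor_sub (a b : ℝ) :
    IntervalIntegrable (fun t : ℝ => |((⌊a + t⌋ : ℤ) : ℝ) - (⌊b + t⌋ : ℤ)|)
      MeasureTheory.volume 0 1 ∧
    ∫ t in (0 : ℝ)..1, |((⌊a + t⌋ : ℤ) : ℝ) - (⌊b + t⌋ : ℤ)| = |a - b| := by
  wlog h : b ≤ a generalizing a b
  · have := this b a (le_of_not_ge h)
    simpa only [abs_sub_comm] using this
  have heq : (fun t : ℝ => |((⌊a + t⌋ : ℤ) : ℝ) - (⌊b + t⌋ : ℤ)|) =
      fun t : ℝ => ((⌊a + t⌋ : ℤ) : ℝ) - (⌊b + t⌋ : ℤ) := by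
    ext t
    rw [abs_of_nonneg]
    rw [sub_nonneg, Int.cast_le]
    exact Int.floor_mono (by linarith)
  rw [heq, abs_of_nonneg (sub_nonneg.2 h)]
  refine ⟨(intervalIntegrable_floor_add a).sub (intervalIntegrable_floor_add b), ?_⟩
  rw [intervalIntegral.integral_sub (intervalIntegrable_floor_add a)
    (intervalIntegrable_floor_add b), integral_floor_add, integral_floor_add]
  ring

/-- The half-open interval matters: only shifts below 1 fix the integral points. -/
theorem exists_le_intervalIntegral {f : ℝ → ℝ}
    (hf : IntervalIntegrable f MeasureTheory.volume 0 1) :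
    ∃ t ∈ Set.Ico (0 : ℝ) 1, f t ≤ ∫ t in (0 : ℝ)..1, f t := by
  by_contra! h
  have hpos := intervalIntegral.intervalIntegral_pos_of_pos_on
    (f := fun t => f t - ∫ t in (0 : ℝ)..1, f t) (hf.sub intervalIntegrable_const)
    (fun t ht => sub_pos.2 (h t ⟨ht.1.le, ht.2⟩)) one_pos
  rw [intervalIntegral.integral_sub hf intervalIntegrable_const] at hpos
  simp at hpos

/-- Rounding a coordinate, shifted by `t`, to `{0, …, n - 1}`. -/
noncomputable def roundCoord (n : ℕ) (t x : ℝ) : ℕ := min ⌊x + t⌋₊ (n - 1)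

/-- Rounding a point to the `n × n` grid. -/
noncomputable def roundPoint (n : ℕ) (t s : ℝ) (p : ℝ × ℝ) : ℕ × ℕ :=
  (roundCoord n t p.1, roundCoord n s p.2)

theorem roundCoord_natCast {n x : ℕ} {t : ℝ} (ht : t ∈ Set.Ico (0 : ℝ) 1) (hx : x < n) :
    roundCoord n t x = x := by
  have : ⌊(x : ℝ) + t⌋₊ = x := by
    rw [Nat.floor_eq_iff (by have := ht.1; positivity)]
    exact ⟨by linarith [ht.1], by linarith [ht.2]⟩
  rw [roundCoord, this]
  omega

theorem roundPoint_inBox {n : ℕ} (hn : 0 < n) (t s : ℝ) (p : ℝ × ℝ) :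
    InBox n (roundPoint n t s p) := by
  simp only [InBox, roundPoint, roundCoord]
  omega

/-- Clamping to `{0, …, n - 1}` does not increase distances; the natural floor does the clamping at
0. -/
theorem dist_roundCoord_le (n : ℕ) (t a b : ℝ) :
    (((roundCoord n t a - roundCoord n t b) + (roundCoord n t b - roundCoord n t a) : ℕ) : ℝ) ≤
      |((⌊a + t⌋ : ℤ) : ℝ) - (⌊b + t⌋ : ℤ)| := by
  rw [roundCoord, roundCoord, ← Int.floor_toNat, ← Int.floor_toNat]
  generalize ⌊a + t⌋ = A
  generalize ⌊b + t⌋ = B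
  have h : (((min A.toNat (n - 1) - min B.toNat (n - 1)) +
      (min B.toNat (n - 1) - min A.toNat (n - 1)) : ℕ) : ℤ) ≤ |A - B| := by
    rcases le_total A B with h | h
    · rw [abs_of_nonpos (by omega)]
      omega
    · rw [abs_of_nonneg (by omega)]
      omega
  exact_mod_cast h

/-- `X` and `Y` are the horizontal and vertical lengths after rounding, before clamping. As each
depends on one shift only, the two shifts can be chosen separately. -/
theorem Grown.round_aux {n : ℕ} {r : ℝ × ℝ} {W : Set (ℝ × ℝ)} {l : ℝ}
    (h : Grown realDist r W l) :
    ∃ X Y : ℝ → ℝ, IntervalIntegrable X MeasureTheory.volume 0 1 ∧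
      IntervalIntegrable Y MeasureTheory.volume 0 1 ∧
      (∫ t in (0 : ℝ)..1, X t) + (∫ t in (0 : ℝ)..1, Y t) = l ∧
      ∀ t s, ∃ L : ℕ, (L : ℝ) ≤ X t + Y s ∧
        Grown gridDist (roundPoint n t s r) (roundPoint n t s '' W) L := by
  induction h with
  | base =>
    refine ⟨0, 0, intervalIntegrable_const, intervalIntegrable_const, by simp, fun t s =>
      ⟨0, by simp, ?_⟩⟩
    rw [Set.image_singleton]
    exact .base
  | @step W l p q _ hp ih =>
    obtain ⟨X, Y, hX, hY, havg, hL⟩ := ih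
    obtain ⟨i₁, e₁⟩ := integral_abs_floor_sub p.1 q.1
    obtain ⟨i₂, e₂⟩ := integral_abs_floor_sub p.2 q.2
    refine ⟨fun t => X t + _, fun s => Y s + _, hX.add i₁, hY.add i₂, ?_, fun t s => ?_⟩
    · rw [intervalIntegral.integral_add hX i₁, intervalIntegral.integral_add hY i₂, e₁, e₂,
        ← havg, realDist]
      ring
    · obtain ⟨L, hle, hG⟩ := hL t s
      have hG' := hG.step (roundPoint n t s q) (Set.mem_image_of_mem _ hp)
      rw [← Set.image_insert_eq] at hG'
      refine ⟨_, ?_, hG'⟩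
      · have h₁ := dist_roundCoord_le n t p.1 q.1
        have h₂ := dist_roundCoord_le n s p.2 q.2
        rw [gridDist, Nat.cast_add, Nat.cast_add]
        simp only [roundPoint]
        linarith

/-- A tree of length less than `ℓ + 1` can be rounded to a grid tree of length at most `ℓ`. -/
theorem Grown.round {n ℓ : ℕ} {r : ℝ × ℝ} {W : Set (ℝ × ℝ)} {l : ℝ}
    (h : Grown realDist r W l) (hl : l < ℓ + 1) :
    ∃ t ∈ Set.Ico (0 : ℝ) 1, ∃ s ∈ Set.Ico (0 : ℝ) 1, ∃ L ≤ ℓ,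
      Grown gridDist (roundPoint n t s r) (roundPoint n t s '' W) L := by
  obtain ⟨X, Y, hX, hY, havg, hL⟩ := h.round_aux (n := n)
  obtain ⟨t, ht, hXt⟩ := exists_le_intervalIntegral hX
  obtain ⟨s, hs, hYs⟩ := exists_le_intervalIntegral hY
  obtain ⟨L, hle, hG⟩ := hL t s
  refine ⟨t, ht, s, hs, L, ?_, hG⟩
  have : (L : ℝ) < ((ℓ + 1 : ℕ) : ℝ) := by
    push_cast
    linarith
  exact Nat.lt_succ_iff.1 (Nat.cast_lt.1 this)

end Rounding

/-! ### Rectilinear Steiner trees and grown trees -/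

section SteinerTrees

/-- While some vertex is missing, connectedness provides an edge leaving the current set. The cost
is bounded by the edges inside this set, and the leaving edge was not yet among them. -/
theorem exists_grown_of_connected {V P : Type*} [Fintype V] [DecidableEq V] (G : SimpleGraph V)
    [Fintype G.edgeSet] (hG : G.Connected) (pos : V → P) (d : P → P → ℝ) (len : Sym2 V → ℝ)
    (hlen : ∀ u v, G.Adj u v → d (pos u) (pos v) = len s(u, v)) (hnonneg : ∀ e, 0 ≤ len e)
    (r : V) :
    ∃ l, Grown d (pos r) (Set.range pos) l ∧ l ≤ ∑ e ∈ G.edgeFinset, len e := by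
  classical
  have key : ∀ j < Fintype.card V, ∃ U : Finset V, U.card = j + 1 ∧ r ∈ U ∧ ∃ l,
      Grown d (pos r) (pos '' U) l ∧
      l ≤ ∑ e ∈ G.edgeFinset with (∀ x ∈ e, x ∈ U), len e := by
    intro j
    induction j with
    | zero =>
      intro _
      refine ⟨{r}, by simp, by simp, 0, ?_, Finset.sum_nonneg fun e _ => hnonneg e⟩
      rw [Finset.coe_singleton, Set.image_singleton]
      exact .base
    | succ j ih =>
      intro hj
      obtain ⟨U, hU, hr, l, hl, hle⟩ := ih (by omega)
      obtain ⟨x, hx⟩ : ∃ x, x ∉ U := by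
        by_contra! hall
        have := Finset.card_eq_iff_eq_univ U |>.2 (Finset.eq_univ_of_forall hall)
        omega
      obtain ⟨p⟩ := hG.preconnected r x
      obtain ⟨e, -, he₁, he₂⟩ := p.exists_boundary_dart (U : Set V) hr hx
      refine ⟨insert e.snd U, by rw [Finset.card_insert_of_notMem he₂, hU],
        Finset.mem_insert_of_mem hr, l + d (pos e.fst) (pos e.snd), ?_, ?_⟩
      · rw [Finset.coe_insert, Set.image_insert_eq]
        exact hl.step _ (Set.mem_image_of_mem _ he₁)
      · rw [hlen _ _ e.adj, add_comm]
        have hnot : s(e.fst, e.snd) ∉ {e ∈ G.edgeFinset | ∀ x ∈ e, x ∈ U} := by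
          simp only [Finset.mem_filter, not_and]
          intro _ h
          exact he₂ (h e.snd (by simp))
        refine (add_le_add_right hle _).trans ?_
        rw [← Finset.sum_insert hnot]
        refine Finset.sum_le_sum_of_subset_of_nonneg ?_ fun e _ _ => hnonneg e
        intro f hf
        rw [Finset.mem_insert, Finset.mem_filter] at hf
        rw [Finset.mem_filter]
        rcases hf with rfl | ⟨hf, hf'⟩
        · refine ⟨by simp, fun x hx => ?_⟩
          rcases Sym2.mem_iff.1 hx with rfl | rfl
          · exact Finset.mem_insert_of_mem he₁
          · exact Finset.mem_insert_self _ _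
        · exact ⟨hf, fun x hx => Finset.mem_insert_of_mem (hf' x hx)⟩
  have hcard : 0 < Fintype.card V := Fintype.card_pos_iff.2 ⟨r⟩
  obtain ⟨U, hU, -, l, hl, hle⟩ := key (Fintype.card V - 1) (by omega)
  have hUuniv : U = Finset.univ := (Finset.card_eq_iff_eq_univ U).1 (by omega)
  subst hUuniv
  rw [Finset.coe_univ, Set.image_univ] at hl
  exact ⟨l, hl, hle.trans (Finset.sum_le_sum_of_subset_of_nonneg (Finset.filter_subset _ _)
    fun e _ _ => hnonneg e)⟩

theorem RectilinearSteinerTree.exists_grown {K : Set (ℝ × ℝ)} (T : RectilinearSteinerTree K)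
    {r : ℝ × ℝ} (hr : r ∈ K) :
    ∃ W l, Grown realDist r W l ∧ l ≤ T.length ∧ K ⊆ W := by
  classical
  obtain ⟨l, hl, hle⟩ := exists_grown_of_connected T.graph T.isTree.1 Subtype.val realDist
    (fun e => segmentLength (e.map Subtype.val)) (fun u v _ => rfl)
    (fun e => by
      induction e with | _ u v
      simp only [Sym2.map_mk, segmentLength, Sym2.lift_mk]
      positivity) ⟨r, T.terminals_subset hr⟩
  refine ⟨_, l, hl, ?_, ?_⟩
  · rw [RectilinearSteinerTree.length]
    convert hle
  · rw [Subtype.range_val]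
    exact T.terminals_subset

/-- Unit steps in the `n × n` grid. -/
def UnitArc (n : ℕ) (p q : ℕ × ℕ) : Prop := InBox n q ∧ gridDist p q = 1

/-- Each join is replaced by an L-shaped path of unit steps, which stays in the box and adds at most
its length in points. -/
theorem Grown.exists_spread {n : ℕ} {r : ℕ × ℕ} {W : Set (ℕ × ℕ)} {L : ℕ}
    (h : Grown gridDist r W L) (hW : ∀ p ∈ W, InBox n p) :
    ∃ U, Spread (UnitArc n) r U ∧ (∀ p ∈ W, p ∈ U) ∧ U.card ≤ L + 1 := by
  induction h with
  | base => exact ⟨{r}, .base, by simp, by simp⟩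
  | @step W l p q _ hp ih =>
    obtain ⟨U, hU, hWU, hcard⟩ := ih fun x hx => hW x (Or.inr hx)
    have hpb := hW p (Or.inr hp)
    have hqb := hW q (Or.inl rfl)
    simp only [InBox] at hpb hqb
    have hor : ∃ U', Spread (UnitArc n) r U' ∧ U ⊆ U' ∧
        U'.card ≤ U.card + ((p.1 - q.1) + (q.1 - p.1)) ∧ (q.1, p.2) ∈ U' := by
      rcases le_total p.1 q.1 with hle | hle
      · obtain ⟨U', h₁, h₂, h₃, h₄⟩ := hU.path (fun i => (p.1 + i, p.2)) (q.1 - p.1) (hWU p hp)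
          (by intro i hi; simp only [UnitArc, InBox, gridDist]; omega)
        refine ⟨U', h₁, h₂, by omega, ?_⟩
        convert h₄ using 2
        omega
      · obtain ⟨U', h₁, h₂, h₃, h₄⟩ := hU.path (fun i => (p.1 - i, p.2)) (p.1 - q.1) (hWU p hp)
          (by intro i hi; simp only [UnitArc, InBox, gridDist]; omega)
        refine ⟨U', h₁, h₂, by omega, ?_⟩
        convert h₄ using 2
        omega
    obtain ⟨U₁, h₁, s₁, c₁, m₁⟩ := hor
    have ver : ∃ U', Spread (UnitArc n) r U' ∧ U₁ ⊆ U' ∧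
        U'.card ≤ U₁.card + ((p.2 - q.2) + (q.2 - p.2)) ∧ (q.1, q.2) ∈ U' := by
      rcases le_total p.2 q.2 with hle | hle
      · obtain ⟨U', h₁, h₂, h₃, h₄⟩ := h₁.path (fun i => (q.1, p.2 + i)) (q.2 - p.2) m₁
          (by intro i hi; simp only [UnitArc, InBox, gridDist]; omega)
        refine ⟨U', h₁, h₂, by omega, ?_⟩
        convert h₄ using 2
        omega
      · obtain ⟨U', h₁, h₂, h₃, h₄⟩ := h₁.path (fun i => (q.1, p.2 - i)) (p.2 - q.2) m₁
          (by intro i hi; simp only [UnitArc, InBox, gridDist]; omega)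
        refine ⟨U', h₁, h₂, by omega, ?_⟩
        convert h₄ using 2
        omega
    obtain ⟨U₂, h₂, s₂, c₂, m₂⟩ := ver
    refine ⟨U₂, h₂, ?_, by simp only [gridDist]; omega⟩
    rintro x (rfl | hx)
    · exact m₂
    · exact s₂ (s₁ (hWU x hx))

/-- A grid point as a point of the plane. -/
def gridPoint (p : ℕ × ℕ) : ℝ × ℝ := (p.1, p.2)

theorem gridPoint_injective : Function.Injective gridPoint := by
  rintro ⟨a, b⟩ ⟨c, d⟩ h
  simpa [gridPoint] using h

theorem segment_unit_cases {p q : ℕ × ℕ} (h : gridDist p q = 1) :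
    (∃ i j : ℕ, s(p, q) = s((i, j), (i + 1, j)) ∧ ∀ z ∈ segment ℝ (gridPoint p) (gridPoint q),
      (i : ℝ) ≤ z.1 ∧ z.1 ≤ i + 1 ∧ z.2 = j) ∨
    (∃ i j : ℕ, s(p, q) = s((i, j), (i, j + 1)) ∧ ∀ z ∈ segment ℝ (gridPoint p) (gridPoint q),
      (j : ℝ) ≤ z.2 ∧ z.2 ≤ j + 1 ∧ z.1 = i) := by
  obtain ⟨a, b⟩ := p
  obtain ⟨c, d⟩ := q
  simp only [gridDist] at h
  have hz : ∀ z ∈ segment ℝ (gridPoint (a, b)) (gridPoint (c, d)),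
      z.1 ∈ Set.uIcc (a : ℝ) c ∧ z.2 ∈ Set.uIcc (b : ℝ) d := by
    intro z hz
    have := Prod.segment_subset _ _ hz
    rwa [segment_eq_uIcc, segment_eq_uIcc] at this
  obtain ⟨rfl, rfl⟩ | ⟨rfl, rfl⟩ | ⟨rfl, rfl⟩ | ⟨rfl, rfl⟩ :
      (c = a + 1 ∧ d = b) ∨ (a = c + 1 ∧ d = b) ∨ (c = a ∧ d = b + 1) ∨ (c = a ∧ b = d + 1) := by
    omega
  · refine Or.inl ⟨a, d, rfl, fun z hzs => ?_⟩
    have := hz z hzs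
    rw [Set.uIcc_of_le (by push_cast; linarith), Set.uIcc_self] at this
    push_cast at this
    exact ⟨this.1.1, this.1.2, this.2⟩
  · refine Or.inl ⟨c, d, Sym2.eq_swap, fun z hzs => ?_⟩
    have := hz z hzs
    rw [Set.uIcc_of_ge (by push_cast; linarith), Set.uIcc_self] at this
    push_cast at this
    exact ⟨this.1.1, this.1.2, this.2⟩
  · refine Or.inr ⟨c, b, rfl, fun z hzs => ?_⟩
    have := hz z hzs
    rw [Set.uIcc_self, Set.uIcc_of_le (by push_cast; linarith)] at this
    push_cast at this
    exact ⟨this.2.1, this.2.2, this.1⟩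
  · refine Or.inr ⟨c, d, Sym2.eq_swap, fun z hzs => ?_⟩
    have := hz z hzs
    rw [Set.uIcc_self, Set.uIcc_of_ge (by push_cast; linarith)] at this
    push_cast at this
    exact ⟨this.2.1, this.2.2, this.1⟩

theorem mem_pair_of_sym2_eq {p q a b : ℕ × ℕ} (h : s(p, q) = s(a, b)) {z : ℝ × ℝ}
    (hz : z = gridPoint a ∨ z = gridPoint b) :
    z ∈ ({gridPoint p, gridPoint q} : Set (ℝ × ℝ)) := by
  rcases Sym2.eq_iff.1 h with ⟨rfl, rfl⟩ | ⟨rfl, rfl⟩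
  · exact hz
  · exact hz.symm

theorem natCast_cases {i k : ℕ} (h₁ : (i : ℝ) ≤ k) (h₂ : (k : ℝ) ≤ i + 1) : k = i ∨ k = i + 1 := by
  have h₁' : i ≤ k := by exact_mod_cast h₁
  have h₂' : k ≤ i + 1 := by exact_mod_cast h₂
  omega

/-- Distinct unit intervals on a line with integral endpoints meet only in a common endpoint. -/
theorem eq_of_mem_unit_intervals {i k : ℕ} (hik : i ≠ k) {x : ℝ} (h₁ : (i : ℝ) ≤ x)
    (h₂ : x ≤ i + 1) (h₃ : (k : ℝ) ≤ x) (h₄ : x ≤ k + 1) :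
    (x = i ∨ x = i + 1) ∧ (x = k ∨ x = k + 1) := by
  rcases lt_or_gt_of_ne hik with h | h
  · have : (i : ℝ) + 1 ≤ k := by exact_mod_cast h
    exact ⟨Or.inr (by linarith), Or.inl (by linarith)⟩
  · have : (k : ℝ) + 1 ≤ i := by exact_mod_cast h
    exact ⟨Or.inl (by linarith), Or.inr (by linarith)⟩

/-- Parallel segments that meet lie on one line and are distinct unit intervals there. For
perpendicular ones, each segment fixes one coordinate of the common point to an integer, so the
point is an endpoint of both. -/
theorem unit_segments_inter {p q p' q' : ℕ × ℕ} (h : gridDist p q = 1) (h' : gridDist p' q' = 1)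
    (hne : s(p, q) ≠ s(p', q')) :
    segment ℝ (gridPoint p) (gridPoint q) ∩ segment ℝ (gridPoint p') (gridPoint q') ⊆
      ({gridPoint p, gridPoint q} ∩ {gridPoint p', gridPoint q'} : Set (ℝ × ℝ)) := by
  rintro z ⟨hz, hz'⟩
  rcases segment_unit_cases h with ⟨i, j, hs, hseg⟩ | ⟨i, j, hs, hseg⟩ <;>
  rcases segment_unit_cases h' with ⟨i', j', hs', hseg'⟩ | ⟨i', j', hs', hseg'⟩ <;>
  obtain ⟨a₁, a₂, a₃⟩ := hseg z hz <;> obtain ⟨b₁, b₂, b₃⟩ := hseg' z hz'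
  · have hj : j = j' := by
      have : (j : ℝ) = j' := by rw [← a₃, b₃]
      exact_mod_cast this
    have hi : i ≠ i' := by
      rintro rfl
      exact hne (by rw [hs, hs', hj])
    obtain ⟨c₁, c₂⟩ := eq_of_mem_unit_intervals hi a₁ a₂ b₁ b₂
    refine ⟨mem_pair_of_sym2_eq hs ?_, mem_pair_of_sym2_eq hs' ?_⟩
    · simpa [gridPoint, Prod.ext_iff, a₃] using c₁
    · simpa [gridPoint, Prod.ext_iff, b₃] using c₂
  · rw [b₃] at a₁ a₂
    rw [a₃] at b₁ b₂
    refine ⟨mem_pair_of_sym2_eq hs ?_, mem_pair_of_sym2_eq hs' ?_⟩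
    · rcases natCast_cases a₁ a₂ with rfl | rfl <;> simp [gridPoint, Prod.ext_iff, a₃, b₃]
    · rcases natCast_cases b₁ b₂ with rfl | rfl <;> simp [gridPoint, Prod.ext_iff, a₃, b₃]
  · rw [b₃] at a₁ a₂
    rw [a₃] at b₁ b₂
    refine ⟨mem_pair_of_sym2_eq hs ?_, mem_pair_of_sym2_eq hs' ?_⟩
    · rcases natCast_cases a₁ a₂ with rfl | rfl <;> simp [gridPoint, Prod.ext_iff, a₃, b₃]
    · rcases natCast_cases b₁ b₂ with rfl | rfl <;> simp [gridPoint, Prod.ext_iff, a₃, b₃]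
  · have hj : i = i' := by
      have : (i : ℝ) = i' := by rw [← a₃, b₃]
      exact_mod_cast this
    have hi : j ≠ j' := by
      rintro rfl
      exact hne (by rw [hs, hs', hj])
    obtain ⟨c₁, c₂⟩ := eq_of_mem_unit_intervals hi a₁ a₂ b₁ b₂
    refine ⟨mem_pair_of_sym2_eq hs ?_, mem_pair_of_sym2_eq hs' ?_⟩
    · simpa [gridPoint, Prod.ext_iff, a₃] using c₁
    · simpa [gridPoint, Prod.ext_iff, b₃] using c₂

/-- The grid graph on a finite set of grid points. -/
def unitGraph (U : Finset (ℕ × ℕ)) : SimpleGraph (U.map ⟨gridPoint, gridPoint_injective⟩) where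
  Adj u v := ∃ p q : ℕ × ℕ, u.1 = gridPoint p ∧ v.1 = gridPoint q ∧ gridDist p q = 1
  symm := ⟨by
    rintro u v ⟨p, q, hp, hq, h⟩
    refine ⟨q, p, hq, hp, ?_⟩
    simp only [gridDist] at *
    omega⟩
  loopless := ⟨by
    rintro u ⟨p, q, hp, hq, h⟩
    have := gridPoint_injective (hp.symm.trans hq)
    subst this
    simp [gridDist] at h⟩

theorem Spread.unitGraph_connected {n : ℕ} {r : ℕ × ℕ} {U : Finset (ℕ × ℕ)}
    (hU : Spread (UnitArc n) r U) : (unitGraph U).Connected := by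
  have key : ∀ D, Spread (UnitArc n) r D → ∀ hD : D ⊆ U, ∀ p (hp : p ∈ D),
      (unitGraph U).Reachable ⟨gridPoint r, Finset.mem_map_of_mem _ hU.root_mem⟩
        ⟨gridPoint p, Finset.mem_map_of_mem _ (hD hp)⟩ := by
    intro D hDs
    induction hDs with
    | base =>
      intro hD p hp
      obtain rfl := Finset.mem_singleton.1 hp
      exact SimpleGraph.Reachable.refl _
    | @step D a b _ ha hab ih =>
      intro hD p hp
      have hD' : D ⊆ U := (Finset.subset_insert _ _).trans hD
      rcases Finset.mem_insert.1 hp with rfl | hp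
      · refine (ih hD' a ha).trans (SimpleGraph.Adj.reachable ?_)
        exact ⟨a, p, rfl, rfl, hab.2⟩
      · exact ih hD' p hp
  have hr : ∀ v, (unitGraph U).Reachable ⟨gridPoint r, Finset.mem_map_of_mem _ hU.root_mem⟩ v := by
    rintro ⟨v, hv⟩
    obtain ⟨p, hp, rfl⟩ := Finset.mem_map.1 hv
    exact key U hU subset_rfl p hp
  exact (SimpleGraph.connected_iff_exists_forall_reachable _).2 ⟨_, hr⟩

/-- A connected set of grid points yields a rectilinear Steiner tree. -/
theorem Spread.exists_rst {n : ℕ} {r : ℕ × ℕ} {U : Finset (ℕ × ℕ)}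
    (hU : Spread (UnitArc n) r U) {K : Set (ℝ × ℝ)} (hK : ∀ x ∈ K, ∃ p ∈ U, x = gridPoint p) :
    ∃ T : RectilinearSteinerTree K, T.length + 1 = U.card := by
  classical
  -- A spanning tree has one edge fewer than vertices, and all edges have length 1.
  obtain ⟨T, hle, hT⟩ := hU.unitGraph_connected.exists_isTree_le
  refine ⟨⟨U.map ⟨gridPoint, gridPoint_injective⟩, T, hT, ?_, ?_, ?_⟩, ?_⟩
  · intro x hx
    obtain ⟨p, hp, rfl⟩ := hK x hx
    exact Finset.mem_map_of_mem ⟨gridPoint, gridPoint_injective⟩ hp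
  · intro u v huv
    obtain ⟨p, q, hp, hq, h⟩ := hle huv
    rw [hp, hq]
    simp only [gridPoint, Nat.cast_inj]
    simp only [gridDist] at h
    omega
  · intro a b c d hab hcd hne
    obtain ⟨p, q, hp, hq, h⟩ := hle hab
    obtain ⟨p', q', hp', hq', h'⟩ := hle hcd
    rw [hp, hq, hp', hq']
    refine unit_segments_inter h h' fun heq => hne ?_
    apply Sym2.map.injective Subtype.val_injective
    rw [Sym2.map_mk, Sym2.map_mk, hp, hq, hp', hq']
    exact congrArg (Sym2.map gridPoint) heq
  · rw [RectilinearSteinerTree.length, Finset.sum_congr rfl (g := fun _ => (1 : ℝ))]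
    · have := hT.card_edgeFinset
      rw [Fintype.card_coe, Finset.card_map] at this
      simp only [Finset.sum_const, nsmul_eq_mul, mul_one]
      rw [← this]
      push_cast
      congr! 3
    · intro e he
      induction e with | _ u v
      obtain ⟨p, q, hp, hq, h⟩ := hle (SimpleGraph.mem_edgeFinset.1 he)
      have hlen : segmentLength (Sym2.map Subtype.val s(u, v)) =
          segmentLength s(gridPoint p, gridPoint q) := by
        rw [← hp, ← hq]
        rfl
      refine hlen.trans ?_
      simp only [segmentLength, Sym2.lift_mk, gridPoint]
      rcases segment_unit_cases h with ⟨i, j, hs, -⟩ | ⟨i, j, hs, -⟩ <;>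
        rcases Sym2.eq_iff.1 hs with ⟨rfl, rfl⟩ | ⟨rfl, rfl⟩ <;> simp

end SteinerTrees

/-! ### The reduction -/

section Reduction

variable {n : ℕ} {K : Finset (Fin n × Fin n)} {low : Fin n × Fin n}

theorem Grown.map {P P' R R' : Type*} [AddMonoid R] [AddMonoid R'] {d : P → P → R}
    {d' : P' → P' → R'} (f : P → P') (g : R →+ R') (hfg : ∀ p q, d' (f p) (f q) = g (d p q))
    {r : P} {W : Set P} {l : R} (h : Grown d r W l) : Grown d' (f r) (f '' W) (g l) := by
  induction h with
  | base =>
    rw [Set.image_singleton, map_zero]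
    exact .base
  | step q _ hp ih =>
    rw [Set.image_insert_eq, map_add, ← hfg]
    exact ih.step _ (Set.mem_image_of_mem f hp)

theorem abs_natCast_sub (a b : ℕ) : |(a : ℝ) - b| = (((a - b) + (b - a) : ℕ) : ℝ) := by
  rcases le_total a b with h | h
  · rw [Nat.sub_eq_zero_of_le h, Nat.zero_add, Nat.cast_sub h, abs_sub_comm,
      abs_of_nonneg (sub_nonneg.2 (Nat.cast_le.2 h))]
  · rw [Nat.sub_eq_zero_of_le h, Nat.add_zero, Nat.cast_sub h,
      abs_of_nonneg (sub_nonneg.2 (Nat.cast_le.2 h))]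

theorem exists_flipSequence_of_rst (hlow : low ∈ K) (hmin : ∀ v ∈ K, low.2 ≤ v.2) {ℓ : ℕ}
    (T : RectilinearSteinerTree (planePoints K)) (hT : T.length ≤ (ℓ : ℝ)) :
    ∃ m ≤ 4 * (8 * n) * ℓ + 8 * K.card,
      HasFlipSequence (reductionGraph n) (initialMatching K low) (targetMatching K low) m := by
  have hn : 0 < n := Nat.zero_lt_of_lt low.1.2
  obtain ⟨W, l, hG, hl, hW⟩ :=
    T.exists_grown (r := (((low.1 : ℕ) : ℝ), ((low.2 : ℕ) : ℝ))) ⟨low, hlow, rfl⟩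
  -- Translation by an integer keeps terminals at grid points, which rounding fixes. Other vertices
  -- may lie outside the box and are clamped into it.
  have hG' := hG.map (d' := realDist) (fun p => (p.1, p.2 - ((low.2 : ℕ) : ℝ)))
    (AddMonoidHom.id ℝ) (by
      intro p q
      simp [realDist])
  obtain ⟨t, ht, s, hs, L, hL, hR⟩ := hG'.round (n := n) (ℓ := ℓ)
    (by simp only [AddMonoidHom.id_apply]; linarith)
  have hpt : ∀ v ∈ K, roundPoint n t s (((v.1 : ℕ) : ℝ), ((v.2 : ℕ) : ℝ) - ((low.2 : ℕ) : ℝ)) =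
      relativePoint low v := by
    intro v hv
    have hle : (low.2 : ℕ) ≤ v.2 := hmin v hv
    have hv2 := v.2.2
    rw [← Nat.cast_sub hle, roundPoint, relativePoint, roundCoord_natCast ht v.1.2,
      roundCoord_natCast hs (by omega)]
  rw [hpt low hlow] at hR
  obtain ⟨m, hm, hseq⟩ := hR.exists_flipSequence hlow hmin (fun p hp => by
      obtain ⟨x, -, rfl⟩ := hp
      exact roundPoint_inBox hn t s x)
    (fun v hv => by
      rw [← hpt v hv]
      exact Set.mem_image_of_mem _ (Set.mem_image_of_mem _ (hW ⟨v, hv, rfl⟩)))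
  refine ⟨m, hm.trans ?_, hseq⟩
  gcongr

theorem Spread.inBox {r : ℕ × ℕ} {U : Finset (ℕ × ℕ)} (h : Spread (UnitArc n) r U)
    (hr : InBox n r) : ∀ p ∈ U, InBox n p := by
  induction h with
  | base => simpa using hr
  | step _ _ hab ih =>
    intro p hp
    rcases Finset.mem_insert.1 hp with rfl | hp
    · exact hab.1
    · exact ih p hp

/-- The second bound comes from counting: the unit steps stay in the box, so the tree has at most `n
* n` vertices, whatever `L` is. -/
theorem Grown.exists_rst {r : ℕ × ℕ} {W : Set (ℕ × ℕ)} {L : ℕ} (h : Grown gridDist r W L)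
    (hW : ∀ p ∈ W, InBox n p) (hK : ∀ v ∈ K, ((v.1 : ℕ), (v.2 : ℕ)) ∈ W) :
    ∃ T : RectilinearSteinerTree (planePoints K), T.length ≤ (L : ℝ) ∧
      T.length + 1 ≤ ((n * n : ℕ) : ℝ) := by
  obtain ⟨U, hU, hWU, hcard⟩ := h.exists_spread hW
  obtain ⟨T, hT⟩ := hU.exists_rst (K := planePoints K) (by
    rintro _ ⟨v, hv, rfl⟩
    exact ⟨_, hWU _ (hK v hv), rfl⟩)
  refine ⟨T, ?_, ?_⟩
  · have : (U.card : ℝ) ≤ L + 1 := by exact_mod_cast hcard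
    linarith
  · rw [hT, Nat.cast_le]
    have hsub : U ⊆ Finset.range n ×ˢ Finset.range n := by
      intro p hp
      have := hU.inBox (hW r h.root_mem) p hp
      simpa [InBox] using this
    simpa using Finset.card_le_card hsub

theorem exists_grown_finset (r : ℕ × ℕ) (W : Finset (ℕ × ℕ)) :
    ∃ L, Grown gridDist r (insert r (W : Set (ℕ × ℕ))) L := by
  classical
  induction W using Finset.induction_on with
  | empty =>
    refine ⟨0, ?_⟩
    simpa using Grown.base
  | insert q W _ ih =>
    obtain ⟨L, hL⟩ := ih
    refine ⟨L + gridDist r q, ?_⟩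
    rw [Finset.coe_insert, Set.insert_comm]
    exact hL.step q (Set.mem_insert _ _)

/-- The dimer (in natural coordinates) that contains a vertex; the row `0` is merged with the
row `1`. -/
def dimerOf (c : ℕ) (p : ℕ × ℕ) : ℕ × ℕ :=
  if p.2 = 0 then (if p.1 ≤ c then p.1 / 2 else (p.1 - 1) / 2, 1) else (p.1 / 2, p.2)

/-- Right of the hole the pairs in row 0 are offset by one column. A step between rows 0 and 1 may
thus shift the dimer sideways by one, but merging these rows makes its vertical part free. -/
theorem gridDist_dimerOf_le {w h c : ℕ} {u v : Fin w × Fin h} (huv : (gridGraph w h).Adj u v) :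
    gridDist (dimerOf c (coords u)) (dimerOf c (coords v)) ≤ 1 := by
  rw [gridGraph_adj] at huv
  simp only [dimerOf, gridDist]
  split_ifs <;> simp only <;> omega

/-- Only the vertical edges in the last column join different dimers, and they are excluded by `hu`.
-/
theorem dimerOf_mate {u v : Fin (4 * refinedSide n + 1) × Fin (2 * refinedSide n + 1)}
    (huv : s(u, v) ∈ initialMatching K low) (hu : (coords u).1 < 4 * refinedSide n) :
    dimerOf (holeColumn low) (coords u) = dimerOf (holeColumn low) (coords v) := by
  have hc := holeColumn_mod low
  rw [mem_initialMatching] at huv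
  simp only [InitialPair] at huv
  simp only [dimerOf]
  split_ifs <;> apply Prod.ext <;> simp only <;> omega

/-- The lower left dimer of a terminal block must disappear, which forces the exploration to visit
this block at a known position. -/
theorem exists_terminal_edge {v : Fin n × Fin n} (hv : v ∈ K) :
    ∃ e ∈ initialMatching K low \ targetMatching K low, ∃ x ∈ e,
      dimerOf (holeColumn low) (coords x) =
        (16 * n * (v.1 : ℕ), 16 * n * ((v.2 : ℕ) - (low.2 : ℕ)) + 1) := by
  have hg := refinePoint_mem_refinedGrid low v
  have hT : refinePoint low v ∈ refinedTerminals K low := ⟨v, hv, rfl⟩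
  have hx : 8 * n * (v.1 : ℕ) < refinedSide n := hg.1.2
  have hy : 8 * n * ((v.2 : ℕ) - (low.2 : ℕ)) < refinedSide n := hg.2.2
  have hmem := ((validDimer_block_iff hx hy
    (2 * (8 * n * (v.1 : ℕ)), 2 * (8 * n * ((v.2 : ℕ) - (low.2 : ℕ))) + 1)).2 (by simp)).1
  have he : dimerEdge n (2 * (8 * n * (v.1 : ℕ)), 2 * (8 * n * ((v.2 : ℕ) - (low.2 : ℕ))) + 1) ∈
      hEdges n (refinedTerminals K low) := by
    have h₁ : dimerEdge n
        (2 * (8 * n * (v.1 : ℕ)), 2 * (8 * n * ((v.2 : ℕ) - (low.2 : ℕ))) + 1) ∈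
        hEdges n {refinePoint low v} := by
      rw [refinePoint, hEdges_singleton hx hy]
      exact Set.mem_insert _ _
    exact Set.biUnion_subset_biUnion_left (Set.singleton_subset_iff.2 hT) h₁
  refine ⟨_, ⟨hEdges_subset refinedTerminals_subset he, ?_⟩, _, Sym2.mem_mk_left _ _, ?_⟩
  · rw [← switchedMatching_refinedTerminals]
    rintro (h | h)
    · exact h.2 he
    · exact Set.disjoint_left.1 (sEdges_disjoint_hEdges refinedTerminals_subset
        refinedTerminals_subset) h he
  · rw [hmem.coords_entry]
    have e₁ : 16 * n * (v.1 : ℕ) = 2 * (8 * n * (v.1 : ℕ)) := by ring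
    have e₂ : 16 * n * ((v.2 : ℕ) - (low.2 : ℕ)) = 2 * (8 * n * ((v.2 : ℕ) - (low.2 : ℕ))) := by
      ring
    rw [dimerOf, entry, if_neg (by simp), e₁, e₂]
    apply Prod.ext
    · simp only
      omega
    · rfl

theorem exists_rst_of_flipSequence (hcard : K.card < n) (hmin : ∀ v ∈ K, low.2 ≤ v.2) {ℓ m : ℕ}
    (hm : m ≤ 4 * (8 * n) * ℓ + 8 * K.card)
    (h : HasFlipSequence (reductionGraph n) (initialMatching K low) (targetMatching K low) m) :
    ∃ T : RectilinearSteinerTree (planePoints K), T.length ≤ (ℓ : ℝ) := by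
  have hn : 0 < n := by omega
  -- For such `ℓ` a spanning tree of the full grid, of length at most `n * n - 1`, suffices; the
  -- cost `L` of the grown tree is irrelevant here.
  by_cases hℓ : n * n ≤ ℓ + 1
  · obtain ⟨L, hL⟩ := exists_grown_finset (0, 0) (Finset.range n ×ˢ Finset.range n)
    obtain ⟨T, -, hT⟩ := hL.exists_rst (K := K)
      (by
        rintro p (rfl | hp)
        · exact ⟨hn, hn⟩
        · simpa [InBox] using hp)
      (fun v _ => Or.inr (by simp))
    refine ⟨T, ?_⟩
    have : ((n * n : ℕ) : ℝ) ≤ ℓ + 1 := by exact_mod_cast hℓ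
    linarith
  · obtain ⟨s, h0, hm', hs⟩ := h
    -- A flip moves the hole by at most two columns, and `ℓ + 2 ≤ n * n` makes `m` cubic in `n`, so
    -- the part `128 * n ^ 3` of `4 * refinedSide n` is out of range.
    have hX : holeColumn low + 2 * m < 4 * refinedSide n := by
      have h₁ : n * (ℓ + 2) ≤ n * (n * n) := Nat.mul_le_mul_left _ (by omega)
      have h₂ : n * ((low.1 : ℕ) + 1) ≤ n * n := Nat.mul_le_mul_left _ low.1.2
      have h₃ : 4 * refinedSide n = 32 * (n * n) + 128 * (n * (n * n)) := by
        rw [refinedSide]; ring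
      have h₄ : 4 * (8 * n) * ℓ = 32 * (n * ℓ) := by ring
      have h₅ : 32 * n * (low.1 : ℕ) = 32 * (n * (low.1 : ℕ)) := by ring
      rw [holeColumn_eq, h₃, h₅]
      rw [h₄] at hm
      rw [mul_add] at h₁ h₂
      omega
    have hv₀ : coords (gridVertex n (holeColumn low, 0)) = (holeColumn low, 0) :=
      coords_gridVertex (holeColumn_lt low).le (by simp)
    obtain ⟨W, l, hG, hl, hW⟩ := exists_grown_of_flips (G := reductionGraph n)
      (col := fun p => (coords p).1) (d := gridDist)
      (φ := fun p => dimerOf (holeColumn low) (coords p)) (s := s) (m := m)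
      (X := 4 * refinedSide n) (v₀ := gridVertex n (holeColumn low, 0))
      (fun u v huv => by
        rw [gridGraph_adj] at huv
        omega)
      (fun u v huv => gridDist_dimerOf_le huv)
      (fun u v huv hu _ => by
        rw [h0] at huv
        exact dimerOf_mate huv hu)
      (by simpa only [hv₀] using hX)
      (by rw [h0]; exact isOddMatching_initialMatching)
      (by rw [h0]; exact isolated_initialMatching) hs
    rw [h0, hm'] at hl hW
    have hcard' := ncard_targetMatching_sdiff_le (K := K) (low := low)
    have hq : (0 : ℝ) < 16 * n := by positivity
    -- Back to the original scale: a grid unit is `16 * n` dimers, rows start at 1, and `low`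
    -- regains its height.
    have hG' := hG.map (d' := realDist)
      (fun p => ((p.1 : ℝ) / (16 * n), ((p.2 : ℝ) - 1) / (16 * n) + ((low.2 : ℕ) : ℝ)))
      ((AddMonoidHom.mulRight (1 / (16 * n : ℝ))).comp (Nat.castAddMonoidHom ℝ)) (by
        intro p q
        simp only [realDist, gridDist, AddMonoidHom.comp_apply, AddMonoidHom.mulRight_apply,
          Nat.coe_castAddMonoidHom]
        rw [Nat.cast_add, ← abs_natCast_sub, ← abs_natCast_sub, ← sub_div, add_sub_add_right_eq_sub,
          ← sub_div, sub_sub_sub_cancel_right, abs_div, abs_div, abs_of_pos hq]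
        ring)
    have hlen : ((AddMonoidHom.mulRight (1 / (16 * n : ℝ))).comp (Nat.castAddMonoidHom ℝ)) l <
        (ℓ : ℝ) + 1 := by
      simp only [AddMonoidHom.comp_apply, AddMonoidHom.mulRight_apply, Nat.coe_castAddMonoidHom]
      rw [mul_one_div, div_lt_iff₀ hq]
      -- From `2 * l ≤ m + 4 * K.card ≤ 32 * n * ℓ + 12 * K.card` and `K.card < n`.
      have h₁ : l < 16 * (n * ℓ) + 16 * n := by
        have h₂ : 4 * (8 * n) * ℓ = 32 * (n * ℓ) := by ring
        rw [h₂] at hm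
        omega
      have h₃ : (l : ℝ) < 16 * (n * ℓ) + 16 * n := by exact_mod_cast h₁
      linarith
    obtain ⟨t, ht, u, hu, L, hL, hR⟩ := hG'.round (n := n) hlen
    obtain ⟨T, hT, -⟩ := hR.exists_rst (K := K)
      (by
        rintro _ ⟨x, -, rfl⟩
        exact roundPoint_inBox hn t u x)
      (by
        intro v hv
        obtain ⟨e, he, x, hx, hφ⟩ := exists_terminal_edge (low := low) hv
        have hmem := hW e he x hx
        simp only [hφ] at hmem
        refine ⟨_, Set.mem_image_of_mem _ hmem, ?_⟩
        have hle : (low.2 : ℕ) ≤ v.2 := hmin v hv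
        have e₁ : ((16 * n * (v.1 : ℕ) : ℕ) : ℝ) / (16 * n) = (v.1 : ℕ) := by
          push_cast
          field_simp
        have e₂ : (((16 * n * ((v.2 : ℕ) - (low.2 : ℕ)) + 1 : ℕ) : ℝ) - 1) / (16 * n) +
            ((low.2 : ℕ) : ℝ) = (v.2 : ℕ) := by
          push_cast [Nat.cast_sub hle]
          field_simp
          ring
        simp only [e₁, e₂]
        rw [roundPoint, roundCoord_natCast ht v.1.2, roundCoord_natCast hu v.2.2])
    exact ⟨T, hT.trans (Nat.cast_le.2 hL)⟩

end Reduction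

theorem mainTheorem11 (n k : ℕ) (K : Finset (Fin n × Fin n)) (hK : K.card = k) (hkn : k < n)
    (low : Fin n × Fin n) (hlow : low ∈ K) (hmin : ∀ v ∈ K, low.2 ≤ v.2) :
    IsOddMatching (reductionGraph n) (initialMatching K low) ∧
    IsOddMatching (reductionGraph n) (targetMatching K low) ∧
    ∀ ℓ : ℕ,
      (∃ T : RectilinearSteinerTree (planePoints K), T.length ≤ (ℓ : ℝ)) ↔
        ∃ m ≤ 4 * (8 * n) * ℓ + 8 * k,
          HasFlipSequence (reductionGraph n) (initialMatching K low) (targetMatching K low) m := by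
  subst hK
  refine ⟨isOddMatching_initialMatching, isOddMatching_targetMatching, fun ℓ => ⟨?_, ?_⟩⟩
  · rintro ⟨T, hT⟩
    exact exists_flipSequence_of_rst hlow hmin T hT
  · rintro ⟨m, hm, h⟩
    exact exists_rst_of_flipSequence hkn hmin hm h
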